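/- Let $d\ge 2$ be an integer, $c,\lambda,t>0$, and write $E_{\nu,\beta}(x)=\sum_{k\ge 0}x^k/\Gamma(\nu k+\beta)$ ($x\in\mathbb{R}$, $\nu,\beta>0$) for the two-parameter Mittag-Leffler function. For $a>0$ and a random variable $\mathcal N$ with values in $\{0,1,2,\dots\}$, a random flight at time $t$ with Dirichlet parameter $a$ and $\mathcal N$ changes of direction is the position $$c\sum_{j=1}^{\mathcal N+1}\tau_jV_j\in\mathbb{R}^d ,\qquad \tau_{\mathcal N+1}=t-\sum_{j=1}^{\mathcal N}\tau_j ,$$ of a point that starts at the origin and moves with speed $c$, where, conditionally on $\mathcal N=n$, the directions $V_1,\dots,V_{n+1}$ are independent and uniformly distributed on the unit sphere of $\mathbb{R}^d$, they are independent of $(\tau_1,\dots,\tau_n)$, and $(\tau_1,\dots,\tau_n)$ has the rescaled Dirichlet density $$\frac{\Gamma((n+1)a)}{\Gamma(a)^{n+1}}\,\frac{1}{t^{(n+1)a-1}}\prod_{j=1}^{n+1}\tau_j^{a-1},\qquad \tau_1,\dots,\tau_n>0,\quad \tau_{n+1}=t-\sum_{j=1}^n\tau_j>0$$ (for $n=0$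 this means $\tau_1=t$). (i) Let $d\ge 2$, and let $X_d(t)$ be the random flight with $a=d-1$ and with number of changes of direction $\mathcal N_d(t)$ distributed as $$P\{\mathcal N_d(t)=n\}=\frac{1}{E_{\frac{d-1}{2},\frac d2}(\lambda t)}\,\frac{(\lambda t)^n}{\Gamma\left(\frac{d-1}{2}n+\frac d2\right)},\qquad n=0,1,2,\dots$$ Then the absolutely continuous component (with respect to Lebesgue measure) of the law of $X_d(t)$ has the density $$\frac{\lambda t}{\pi^{d/2}}\,\frac{(c^2t^2-\|x\|^2)^{\frac{d-1}{2}-1}}{(ct)^{2(d-1)-1}}\,\frac{E_{\frac{d-1}{2},\frac{d-1}{2}}\left(\frac{\lambda t\,(c^2t^2-\|x\|^2)^{\frac{d-1}{2}}}{(ct)^{d-1}}\right)}{E_{\frac{d-1}{2},\frac d2}(\lambda t)}\qquad\text{for }\|x\|<ct,$$ and $0$ for $\|x\|\ge ct$. (ii) Let $d\ge 3$, and let $Y_d(t)$ be the random flight with $a=\frac d2-1$ and with number of changes of direction $\mathcal M_d(t)$ distributed as $$P\{\mathcal M_d(t)=n\}=\frac{1}{E_{\frac d2-1,\frac d2}(\lambda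 t)}\,\frac{(\lambda t)^n}{\Gamma\left(\left(\frac d2-1\right)n+\frac d2\right)},\qquad n=0,1,2,\dots$$ Then the absolutely continuous component of the law of $Y_d(t)$ has the density $$\frac{\lambda t}{\pi^{d/2}}\,\frac{(c^2t^2-\|y\|^2)^{\frac d2-2}}{(ct)^{4\left(\frac d2-1\right)}}\,\frac{E_{\frac d2-1,\frac d2-1}\left(\frac{\lambda t\,(c^2t^2-\|y\|^2)^{\frac d2-1}}{(ct)^{d-2}}\right)}{E_{\frac d2-1,\frac d2}(\lambda t)}\qquad\text{for }\|y\|<ct,$$ and $0$ for $\|y\|\ge ct$. -/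

import Mathlib

open MeasureTheory

noncomputable section

/-- The two-parameter Mittag-Leffler function `E_{ν,β}(x) = ∑_k x^k / Γ(ν k + β)`. -/
def mittagLeffler (ν β x : ℝ) : ℝ :=
  ∑' k : ℕ, x ^ k / Real.Gamma (ν * k + β)

/-- The weights `x^n / (E_{ν,β}(x) Γ(ν n + β))` of the fractional Poisson law. -/
def fractionalPoissonWeight (ν β x : ℝ) (n : ℕ) : ℝ :=
  1 / mittagLeffler ν β x * (x ^ n / Real.Gamma (ν * n + β))

/-- The open simplex `{s : s_j > 0, ∑ s_j < t}` in `ℝⁿ`. -/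
def openSimplex (t : ℝ) (n : ℕ) : Set (Fin n → ℝ) :=
  {s | (∀ j, 0 < s j) ∧ ∑ j, s j < t}

/-- The `n + 1` successive lengths of time: `s_1, …, s_n` and the remaining `t - ∑ s_j`. -/
def allTimes (t : ℝ) {n : ℕ} (s : Fin n → ℝ) : Fin (n + 1) → ℝ :=
  Fin.snoc (α := fun _ => ℝ) s (t - ∑ j, s j)

/-- The density on `ℝⁿ` of the Dirichlet law with the `n + 1` parameters `(a, …, a)`, rescaled
to total length `t`. -/
def dirichletDensity (a t : ℝ) (n : ℕ) : (Fin n → ℝ) → ℝ :=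
  (openSimplex t n).indicator fun s =>
    Real.Gamma ((n + 1) * a) / Real.Gamma a ^ (n + 1) * (1 / t ^ ((n + 1) * a - 1)) *
      ∏ j, allTimes t s j ^ (a - 1)

/-- The rescaled Dirichlet law of `(τ_1, …, τ_n)`. -/
def dirichletLaw (a t : ℝ) (n : ℕ) : Measure (Fin n → ℝ) :=
  volume.withDensity fun s => ENNReal.ofReal (dirichletDensity a t n s)

/-- The uniform probability law on the unit sphere of `ℝᵈ` (normalised surface measure). -/
def uniformDirection (d : ℕ) : Measure (Metric.sphere (0 : EuclideanSpace ℝ (Fin d)) 1) :=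
  ((volume : Measure (EuclideanSpace ℝ (Fin d))).toSphere Set.univ)⁻¹ •
    (volume : Measure (EuclideanSpace ℝ (Fin d))).toSphere

/-- The ingredients at time `t` of a random flight in `ℝᵈ` with Dirichlet parameter `a`: the number
`N` of changes of direction, the lengths of time `τ 0, τ 1, …` between them and the directions
`V 0, V 1, …`.  Given `N = n`, the times `(τ 0, …, τ (n-1))` have the rescaled Dirichlet law with
parameters `(a, …, a)`, the directions `V 0, …, V n` are independent and uniform on the unit sphere,
and times and directions are independent of each other. -/
structure IsRandomFlight {Ω : Type*} [MeasurableSpace Ω] (P : Measure Ω) {d : ℕ} (a t : ℝ)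
    (N : Ω → ℕ) (τ : ℕ → Ω → ℝ)
    (V : ℕ → Ω → Metric.sphere (0 : EuclideanSpace ℝ (Fin d)) 1) : Prop where
  measurable_number : Measurable N
  measurable_time : ∀ j, Measurable (τ j)
  measurable_direction : ∀ j, Measurable (V j)
  law_given_number : ∀ n : ℕ, P (N ⁻¹' {n}) ≠ 0 →
    (ProbabilityTheory.cond P (N ⁻¹' {n})).map
        (fun ω => ((fun j : Fin n => τ j ω), (fun j : Fin (n + 1) => V j ω))) =
      (dirichletLaw a t n).prod (Measure.pi fun _ => uniformDirection d)

/-- The position at time `t` of a point that starts at the origin and moves with speed `c`: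
`c ∑_{j=1}^{n+1} τ_j V_j` with `n = N` changes of direction and `τ_{n+1} = t - τ_1 - … - τ_n`. -/
def flightPosition {Ω : Type*} {d : ℕ} (c t : ℝ) (N : Ω → ℕ) (τ : ℕ → Ω → ℝ)
    (V : ℕ → Ω → Metric.sphere (0 : EuclideanSpace ℝ (Fin d)) 1) (ω : Ω) :
    EuclideanSpace ℝ (Fin d) :=
  c • ∑ j : Fin (N ω + 1),
    allTimes t (fun i : Fin (N ω) => τ i ω) j • (V j ω : EuclideanSpace ℝ (Fin d))

/-- The measure `ν` has `f` as the density of its absolutely continuous part (with respect to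
Lebesgue measure): `ν` is the sum of its singular part and of the measure with density `f`. -/
def HasAbsContDensity {d : ℕ} (ν : Measure (EuclideanSpace ℝ (Fin d)))
    (f : EuclideanSpace ℝ (Fin d) → ℝ) : Prop :=
  Measurable f ∧ (∀ x, 0 ≤ f x) ∧
    ν = ν.singularPart volume + volume.withDensity fun x => ENNReal.ofReal (f x)

end

/-!
Given `n ≥ 1` changes of direction, the position `X = c ∑ τ_j V_j` has a density proportional to
`((c t)² - ‖x‖²) ^ (β - 1)` on the ball of radius `c t`, with `β = n (d - 1) / 2` for the Dirichlet
parameter `a = d - 1` and `β = n (d / 2 - 1)` for `a = d / 2 - 1`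
(`conditionalFlightLaw_sub_one`, `conditionalFlightLaw_half_sub_one`).  Both laws live on a ball, so
it is enough to compare the moments of `⟨ξ, X⟩` (`Measure.ext_of_inner_moments`).

* By the multinomial theorem, Dirichlet's integral and the moments of a uniform direction, the
  `m`-th moment of `⟨ξ, X⟩` is, up to explicit gamma factors, the `m`-th coefficient of the
  `(n + 1)`-st power of a power series that belongs to a single step
  (`integral_inner_pow_conditionalFlightLaw`).
* For the two values of `a` this series is a power `B_s (κ² X²) ^ p` of a generalised binomial
  series, with `s = 1` (the binomial series) and `s = 2` (the generating function of the Catalan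
  numbers).  By the Rothe–Hagen identity `B_s ^ p * B_s ^ q = B_s ^ (p + q)` (`rotheSeries_mul`) the
  coefficients of its powers are explicit quotients of gamma functions.
* The moments of the density follow from polar coordinates and the beta integral
  (`integral_inner_pow_mul_ballDensity`).

The law of the flight is the mixture of these laws.  The summand `n = 0` is carried by the sphere of
radius `c t`, hence is singular.  In the other summands the factor `Γ (ν n + d / 2)` of the
fractional Poisson weight cancels against the constant of the density, so that they add up to a
Mittag-Leffler series.  That the law has finite total mass makes the sum of the densities finite
almost everywhere (`IsRandomFlight.hasAbsContDensity`).
-/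

/-! ### Rothe's power series -/

/-- The coefficients `A_k(p) = p / k! * ∏_{i=1}^{k-1} (p + s k - i)` of Rothe's power series, that
is of `B_s(X) ^ p` for the generalised binomial series `B_s = 1 + X * B_s ^ s`. -/
noncomputable def rotheCoeff (s : ℕ) : ℕ → ℝ → ℝ
  | 0, _ => 1
  | k + 1, p => p / (k + 1).factorial * ∏ i ∈ Finset.range k, (p + s * (k + 1) - (i + 1))

/-- The recurrence `B_s ^ (p + 1) = B_s ^ p + X * B_s ^ (p + s)`, read off at `X ^ (k + 1)`. -/
theorem rotheCoeff_succ_add_one (s k : ℕ) (p : ℝ) :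
    rotheCoeff s (k + 1) (p + 1) = rotheCoeff s (k + 1) p + rotheCoeff s k (p + s) := by
  cases k with
  | zero => simp [rotheCoeff]
  | succ k =>
    simp only [rotheCoeff]
    rw [Finset.prod_range_succ', Finset.prod_range_succ]
    have h1 : ∀ i ∈ Finset.range k,
        p + 1 + (s : ℝ) * (((k + 1 : ℕ) : ℝ) + 1) - (((i + 1 : ℕ) : ℝ) + 1) =
        p + s * (((k + 1 : ℕ) : ℝ) + 1) - ((i : ℝ) + 1) := by
      intro i _; push_cast; ring
    have h2 : ∀ i ∈ Finset.range k, p + s + (s : ℝ) * ((k : ℝ) + 1) - ((i : ℝ) + 1)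
        = p + s * (((k + 1 : ℕ) : ℝ) + 1) - ((i : ℝ) + 1) := by
      intro i _; push_cast; ring
    rw [Finset.prod_congr rfl h1, Finset.prod_congr rfl h2]
    generalize ∏ i ∈ Finset.range k, (p + s * (((k + 1 : ℕ) : ℝ) + 1) - ((i : ℝ) + 1)) = Q
    rw [Nat.factorial_succ (k + 1)]
    have : ((k + 1).factorial : ℝ) ≠ 0 := by positivity
    push_cast
    field_simp
    ring

/-- `A_k` is a polynomial function. -/
theorem exists_polynomial_eval_eq_rotheCoeff (s k : ℕ) :
    ∃ P : Polynomial ℝ, ∀ p, P.eval p = rotheCoeff s k p := by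
  cases k with
  | zero => exact ⟨1, fun p => by simp [rotheCoeff]⟩
  | succ k =>
    refine ⟨Polynomial.C (((k + 1).factorial : ℝ)⁻¹) * Polynomial.X *
      ∏ i ∈ Finset.range k, (Polynomial.X + Polynomial.C ((s : ℝ) * (k + 1) - (i + 1))),
      fun p => ?_⟩
    simp only [Polynomial.eval_mul, Polynomial.eval_prod, Polynomial.eval_add, Polynomial.eval_X,
      Polynomial.eval_C, rotheCoeff]
    congr 1
    · ring
    · exact Finset.prod_congr rfl fun i _ => by ring

/-- Rothe's power series `B_s ^ p`. -/
noncomputable def rotheSeries (s : ℕ) (p : ℝ) : PowerSeries ℝ :=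
  PowerSeries.mk fun k => rotheCoeff s k p

theorem rotheSeries_zero (s : ℕ) : rotheSeries s 0 = 1 := by
  ext k
  cases k <;> simp [rotheSeries, rotheCoeff, PowerSeries.coeff_one]

theorem rotheSeries_add_one (s : ℕ) (p : ℝ) :
    rotheSeries s (p + 1) = rotheSeries s p + PowerSeries.X * rotheSeries s (p + s) := by
  ext k
  cases k with
  | zero => simp [rotheSeries, rotheCoeff]
  | succ k =>
    simp [rotheSeries, PowerSeries.coeff_succ_X_mul, rotheCoeff_succ_add_one]

theorem rotheSeries_mul_natCast (s : ℕ) (p : ℝ) (q : ℕ) :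
    rotheSeries s p * rotheSeries s q = rotheSeries s (p + q) := by
  ext k
  induction k using Nat.strong_induction_on generalizing q with
  | _ k ih =>
    induction q with
    | zero => simp [rotheSeries_zero]
    | succ q ihq =>
      have hr : rotheSeries s (p + ((q + 1 : ℕ) : ℝ)) = rotheSeries s (p + q)
          + PowerSeries.X * rotheSeries s (p + (q + s : ℕ)) := by
        rw [Nat.cast_succ, ← add_assoc, rotheSeries_add_one]
        push_cast
        rw [add_assoc p]
      have hl : rotheSeries s ((q + 1 : ℕ) : ℝ) = rotheSeries s q
          + PowerSeries.X * rotheSeries s ((q + s : ℕ) : ℝ) := by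
        rw [Nat.cast_succ, rotheSeries_add_one]
        push_cast
        rfl
      rw [hr, hl, mul_add, mul_left_comm, map_add, map_add, ihq]
      cases k with
      | zero => simp
      | succ k =>
        rw [PowerSeries.coeff_succ_X_mul, PowerSeries.coeff_succ_X_mul, ih k (Nat.lt_succ_self k)]

/-- The Rothe–Hagen identity: both sides have coefficients that are polynomial in `q`, and these
agree at every natural number `q`. -/
theorem rotheSeries_mul (s : ℕ) (p q : ℝ) :
    rotheSeries s p * rotheSeries s q = rotheSeries s (p + q) := by
  ext k
  choose P hP using exists_polynomial_eval_eq_rotheCoeff s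
  let L : Polynomial ℝ := ∑ ij ∈ Finset.HasAntidiagonal.antidiagonal k,
    Polynomial.C (rotheCoeff s ij.1 p) * P ij.2
  let R : Polynomial ℝ := (P k).comp (Polynomial.X + Polynomial.C p)
  have hL : ∀ x, L.eval x = PowerSeries.coeff k (rotheSeries s p * rotheSeries s x) := fun x => by
    simp [L, PowerSeries.coeff_mul, rotheSeries, Polynomial.eval_finsetSum, hP]
  have hR : ∀ x, R.eval x = PowerSeries.coeff k (rotheSeries s (p + x)) := fun x => by
    simp [R, rotheSeries, hP, add_comm]
  have hLR : L = R := by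
    refine Polynomial.eq_of_infinite_eval_eq _ _ ((Set.infinite_range_of_injective
      (Nat.cast_injective (R := ℝ))).mono ?_)
    rintro _ ⟨n, rfl⟩
    simp only [Set.mem_ofPred_eq]
    rw [hL, hR, rotheSeries_mul_natCast]
  rw [← hL, ← hR, hLR]

theorem rotheSeries_pow (s : ℕ) (p : ℝ) (n : ℕ) :
    rotheSeries s p ^ n = rotheSeries s (n * p) := by
  induction n with
  | zero => simp [rotheSeries_zero]
  | succ n ih =>
    rw [pow_succ, ih, rotheSeries_mul]
    push_cast
    ring_nf

theorem prod_sub_mul_Gamma (k : ℕ) (z : ℝ) (hz : (k : ℝ) < z) :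
    (∏ i ∈ Finset.range k, (z - (i + 1))) * Real.Gamma (z - k) = Real.Gamma z := by
  induction k with
  | zero => simp
  | succ k ih =>
    push_cast at hz
    have h := Real.Gamma_add_one (s := z - (k + 1)) (by linarith)
    rw [show z - (k + 1) + 1 = z - k by ring] at h
    rw [← ih (by linarith), h, Finset.prod_range_succ]
    push_cast
    ring

theorem rotheCoeff_one_eq (k : ℕ) {p : ℝ} (hp : 0 < p) :
    rotheCoeff 1 k p = Real.Gamma (p + k) / (k.factorial * Real.Gamma p) := by
  have hG := (Real.Gamma_pos_of_pos hp).ne'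
  cases k with
  | zero => simp [rotheCoeff, hG]
  | succ k =>
    have h := prod_sub_mul_Gamma k (p + (k + 1)) (by linarith)
    rw [show p + ((k : ℝ) + 1) - k = p + 1 by ring, Real.Gamma_add_one hp.ne'] at h
    simp only [rotheCoeff, Nat.cast_one, one_mul]
    push_cast
    rw [← h]
    field_simp

theorem rotheCoeff_two_eq (k : ℕ) {p : ℝ} (hp : 0 < p) :
    rotheCoeff 2 k p = p * Real.Gamma (p + 2 * k) / (k.factorial * Real.Gamma (p + k + 1)) := by
  cases k with
  | zero =>
    have hG := (Real.Gamma_pos_of_pos hp).ne'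
    simp [rotheCoeff, Real.Gamma_add_one hp.ne']
    field_simp
  | succ k =>
    have h := prod_sub_mul_Gamma k (p + 2 * (k + 1)) (by linarith)
    rw [show p + 2 * ((k : ℝ) + 1) - k = p + (k + 1) + 1 by ring] at h
    have hG : Real.Gamma (p + (k + 1) + 1) ≠ 0 := (Real.Gamma_pos_of_pos (by positivity)).ne'
    simp only [rotheCoeff, Nat.cast_ofNat]
    push_cast
    rw [← h]
    field_simp

/-- The coefficients of the `n`-th power of a power series, as sums over `n`-tuples of exponents. -/
theorem PowerSeries.coeff_pow_eq_sum_piAntidiag {R : Type*} [CommSemiring R] (φ : PowerSeries R)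
    (n m : ℕ) :
    PowerSeries.coeff m (φ ^ n) =
      ∑ k ∈ (Finset.univ : Finset (Fin n)).piAntidiag m, ∏ j, PowerSeries.coeff (k j) φ := by
  have h := PowerSeries.coeff_prod (fun _ : Fin n => φ) m Finset.univ
  rw [Finset.prod_const, Finset.card_univ, Fintype.card_fin] at h
  rw [h]
  refine Finset.sum_nbij' (fun l => ⇑l) (fun k => Finsupp.equivFunOnFinite.symm k) ?_ ?_ ?_ ?_ ?_
  · intro l hl
    simpa using hl
  · intro k hk
    simpa using hk
  · intro l _
    ext; simp
  · intro k _
    ext; simp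
  · intro l _
    rfl

/-! ### Beta and Dirichlet integrals -/

open ProbabilityTheory (beta) in
theorem lintegral_Ioo_one_rpow_mul_rpow {a b : ℝ} (ha : 0 < a) (hb : 0 < b) :
    ∫⁻ x in Set.Ioo (0 : ℝ) 1, ENNReal.ofReal (x ^ (a - 1) * (1 - x) ^ (b - 1)) =
      ENNReal.ofReal (beta a b) := by
  have hB := ProbabilityTheory.beta_pos ha hb
  have h := ProbabilityTheory.lintegral_betaPDF_eq_one ha hb
  rw [ProbabilityTheory.lintegral_betaPDF] at h
  simp_rw [mul_assoc, ENNReal.ofReal_mul (one_div_pos.2 hB).le] at h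
  rw [lintegral_const_mul _ (by fun_prop)] at h
  calc _ = ENNReal.ofReal (beta a b) * (ENNReal.ofReal (1 / beta a b) *
        ∫⁻ x in Set.Ioo (0 : ℝ) 1, ENNReal.ofReal (x ^ (a - 1) * (1 - x) ^ (b - 1))) := by
        rw [← mul_assoc, ← ENNReal.ofReal_mul hB.le, mul_one_div_cancel hB.ne', ENNReal.ofReal_one,
          one_mul]
    _ = _ := by rw [h, mul_one]

/-- The beta integral over an interval of length `t`. -/
theorem lintegral_Ioo_rpow_mul_rpow {a b t : ℝ} (ha : 0 < a) (hb : 0 < b) (ht : 0 < t) :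
    ∫⁻ x in Set.Ioo (0 : ℝ) t, ENNReal.ofReal (x ^ (a - 1) * (t - x) ^ (b - 1)) =
      ENNReal.ofReal (t ^ (a + b - 1) * ProbabilityTheory.beta a b) := by
  have himg : (fun x : ℝ => t * x) '' Set.Ioo 0 1 = Set.Ioo 0 t := by
    rw [Set.image_mul_left_Ioo ht]; simp
  have h := lintegral_image_eq_lintegral_abs_deriv_mul (s := Set.Ioo (0 : ℝ) 1)
    (f := fun x => t * x) (f' := fun _ => t) measurableSet_Ioo
    (fun x _ => by simpa using ((hasDerivAt_id x).const_mul t).hasDerivWithinAt)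
    (fun x _ y _ hxy => mul_left_cancel₀ ht.ne' hxy)
    (fun x => ENNReal.ofReal (x ^ (a - 1) * (t - x) ^ (b - 1)))
  rw [himg] at h
  rw [h, ENNReal.ofReal_mul (by positivity), ← lintegral_Ioo_one_rpow_mul_rpow ha hb,
    ← lintegral_const_mul _ (by fun_prop)]
  refine setLIntegral_congr_fun measurableSet_Ioo fun x hx => ?_
  obtain ⟨hx0, hx1⟩ := hx
  have h1 : 0 < 1 - x := by linarith
  rw [← ENNReal.ofReal_mul (abs_nonneg _), ← ENNReal.ofReal_mul (by positivity), abs_of_pos ht,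
    show t - t * x = t * (1 - x) by ring, Real.mul_rpow ht.le hx0.le, Real.mul_rpow ht.le h1.le,
    show a + b - 1 = 1 + (a - 1) + (b - 1) by ring, Real.rpow_add ht, Real.rpow_add ht,
    Real.rpow_one]
  congr 1
  ring

theorem allTimes_cons (t x : ℝ) {n : ℕ} (s : Fin n → ℝ) :
    allTimes t (Fin.cons x s : Fin (n + 1) → ℝ) = Fin.cons x (allTimes (t - x) s) := by
  unfold allTimes
  rw [Fin.sum_univ_succ]
  simp only [Fin.cons_zero, Fin.cons_succ]
  rw [← sub_sub, ← Fin.cons_snoc_eq_snoc_cons]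

theorem cons_mem_openSimplex_iff (t x : ℝ) {n : ℕ} (s : Fin n → ℝ) :
    (Fin.cons x s : Fin (n + 1) → ℝ) ∈ openSimplex t (n + 1) ↔
      0 < x ∧ s ∈ openSimplex (t - x) n := by
  simp only [openSimplex, Set.mem_ofPred_eq, Fin.forall_fin_succ, Fin.sum_univ_succ, Fin.cons_zero,
    Fin.cons_succ, lt_sub_iff_add_lt']
  tauto

theorem pos_of_mem_openSimplex {t : ℝ} {n : ℕ} {s : Fin n → ℝ} (hs : s ∈ openSimplex t n) :
    0 < t :=
  (Finset.sum_nonneg fun j _ => (hs.1 j).le).trans_lt hs.2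

theorem allTimes_pos {t : ℝ} {n : ℕ} {s : Fin n → ℝ} (hs : s ∈ openSimplex t n)
    (j : Fin (n + 1)) : 0 < allTimes t s j := by
  refine Fin.lastCases ?_ (fun i => ?_) j
  · simpa [allTimes] using hs.2
  · simpa [allTimes] using hs.1 i

theorem sum_allTimes (t : ℝ) {n : ℕ} (s : Fin n → ℝ) : ∑ j, allTimes t s j = t := by
  simp [allTimes, Fin.sum_univ_castSucc]

theorem measurable_allTimes {n : ℕ} (j : Fin (n + 1)) :
    Measurable fun p : ℝ × (Fin n → ℝ) => allTimes p.1 p.2 j := by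
  refine Fin.lastCases ?_ (fun i => ?_) j
  · simp only [allTimes, Fin.snoc_last]
    fun_prop
  · simp only [allTimes, Fin.snoc_castSucc]
    fun_prop

@[fun_prop]
theorem measurable_allTimes_right (t : ℝ) {n : ℕ} (j : Fin (n + 1)) :
    Measurable fun s : Fin n → ℝ => allTimes t s j :=
  (measurable_allTimes j).comp (measurable_const.prodMk measurable_id)

theorem measurableSet_openSimplex (t : ℝ) (n : ℕ) : MeasurableSet (openSimplex t n) := by
  have : openSimplex t n = (⋂ j, {s | 0 < s j}) ∩ {s | ∑ j, s j < t} := by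
    ext s; simp [openSimplex]
  rw [this]
  refine (MeasurableSet.iInter fun j => ?_).inter ?_
  · exact measurableSet_lt measurable_const (measurable_pi_apply j)
  · exact measurableSet_lt (by fun_prop) measurable_const

theorem lintegral_fin_cons {n : ℕ} {F : (Fin (n + 1) → ℝ) → ENNReal} (hF : Measurable F) :
    ∫⁻ s, F s = ∫⁻ x : ℝ, ∫⁻ s : Fin n → ℝ, F (Fin.cons x s) := by
  have hmp := (volume_preserving_piFinSuccAbove (fun _ : Fin (n + 1) => ℝ) 0).symm
  rw [← hmp.lintegral_comp hF, Measure.volume_eq_prod]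
  refine (lintegral_prod _ (hF.comp (MeasurableEquiv.measurable _)).aemeasurable).trans ?_
  simp [MeasurableEquiv.piFinSuccAbove, Fin.insertNthEquiv]

/-- Dirichlet's integral, by integrating out the first coordinate: the inner integral is of the same
kind with total length `t - x`, and the outer one is a beta integral. -/
theorem lintegral_openSimplex_prod_rpow (n : ℕ) {t : ℝ} (ht : 0 < t) (b : Fin (n + 1) → ℝ)
    (hb : ∀ j, 0 < b j) :
    ∫⁻ s in openSimplex t n, ENNReal.ofReal (∏ j, allTimes t s j ^ (b j - 1)) =
      ENNReal.ofReal (t ^ (∑ j, b j - 1) * ((∏ j, Real.Gamma (b j)) / Real.Gamma (∑ j, b j))) := by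
  induction n generalizing t with
  | zero =>
    have hG := (Real.Gamma_pos_of_pos (hb 0)).ne'
    have hu : openSimplex t 0 = Set.univ := by
      ext s; simp [openSimplex, ht]
    have hl : ∀ s : Fin 0 → ℝ, allTimes t s 0 = t := fun s => by
      simpa using sum_allTimes t s
    simp only [hu, Measure.restrict_univ, Fin.sum_univ_succ, Fin.prod_univ_succ, hl]
    simp [hG, volume_pi]
  | succ n ih =>
    have hm : ∀ (m : ℕ) (t : ℝ) (b : Fin (m + 1) → ℝ), Measurable fun s : Fin m → ℝ =>
        ENNReal.ofReal (∏ j, allTimes t s j ^ (b j - 1)) := fun m t b => by fun_prop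
    have hsum : 0 < ∑ j : Fin (n + 1), b j.succ := Finset.sum_pos (fun j _ => hb _) ⟨0, by simp⟩
    rw [← lintegral_indicator (measurableSet_openSimplex _ _),
      lintegral_fin_cons ((hm _ t b).indicator (measurableSet_openSimplex _ _))]
    have hinner : ∀ x : ℝ, ∫⁻ s : Fin n → ℝ, (openSimplex t (n + 1)).indicator
        (fun s => ENNReal.ofReal (∏ j, allTimes t s j ^ (b j - 1))) (Fin.cons x s) =
        (Set.Ioo 0 t).indicator (fun x => ENNReal.ofReal
          (x ^ (b 0 - 1) * (t - x) ^ (∑ j : Fin (n + 1), b j.succ - 1)) *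
          ENNReal.ofReal ((∏ j : Fin (n + 1), Real.Gamma (b j.succ)) /
            Real.Gamma (∑ j : Fin (n + 1), b j.succ))) x := by
      intro x
      by_cases hx : x ∈ Set.Ioo 0 t
      · have hx0 : 0 ≤ x ^ (b 0 - 1) := Real.rpow_nonneg hx.1.le _
        have htx : 0 < t - x := sub_pos.2 hx.2
        rw [Set.indicator_of_mem hx, ENNReal.ofReal_mul hx0, mul_assoc,
          ← ENNReal.ofReal_mul (Real.rpow_nonneg htx.le _), ← ih htx (fun j => b j.succ)
          (fun j => hb _), ← lintegral_indicator (measurableSet_openSimplex _ _),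
          ← lintegral_const_mul _ ((hm _ _ _).indicator (measurableSet_openSimplex _ _))]
        refine lintegral_congr fun s => ?_
        by_cases hs : s ∈ openSimplex (t - x) n
        · rw [Set.indicator_of_mem hs, Set.indicator_of_mem
            ((cons_mem_openSimplex_iff t x s).2 ⟨hx.1, hs⟩), ← ENNReal.ofReal_mul hx0,
            allTimes_cons, Fin.prod_univ_succ]
          simp
        · rw [Set.indicator_of_notMem hs, Set.indicator_of_notMem
            (fun h => hs ((cons_mem_openSimplex_iff t x s).1 h).2), mul_zero]
      · rw [Set.indicator_of_notMem hx]
        refine (lintegral_congr fun s => ?_).trans lintegral_zero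
        refine Set.indicator_of_notMem (fun h => hx ?_) _
        have h' := (cons_mem_openSimplex_iff t x s).1 h
        exact ⟨h'.1, sub_pos.1 (pos_of_mem_openSimplex h'.2)⟩
    simp_rw [hinner]
    rw [lintegral_indicator measurableSet_Ioo, lintegral_mul_const _ (by fun_prop),
      lintegral_Ioo_rpow_mul_rpow (hb 0) hsum ht, ← ENNReal.ofReal_mul
      (mul_nonneg (Real.rpow_nonneg ht.le _) (ProbabilityTheory.beta_pos (hb 0) hsum).le)]
    rw [ProbabilityTheory.beta, Fin.sum_univ_succ b,
      Fin.prod_univ_succ fun j => Real.Gamma (b j)]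
    have hG := (Real.Gamma_pos_of_pos hsum).ne'
    congr 1
    field_simp

/-- The moments of the rescaled Dirichlet law. -/
theorem lintegral_dirichletLaw_prod_pow {a t : ℝ} (ha : 0 < a) (ht : 0 < t) (n : ℕ)
    (k : Fin (n + 1) → ℕ) :
    ∫⁻ s, ENNReal.ofReal (∏ j, allTimes t s j ^ k j) ∂dirichletLaw a t n =
      ENNReal.ofReal (Real.Gamma ((n + 1) * a) / Real.Gamma ((n + 1) * a + ∑ j, k j) *
        t ^ (∑ j, k j) * ∏ j, (Real.Gamma (a + k j) / Real.Gamma a)) := by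
  have hA : 0 < (n + 1) * a := by positivity
  have hGA := Real.Gamma_pos_of_pos hA
  have hGa := Real.Gamma_pos_of_pos ha
  have hmeas : Measurable (dirichletDensity a t n) := by
    unfold dirichletDensity
    exact Measurable.indicator (by fun_prop) (measurableSet_openSimplex t n)
  have hsum : ∑ j, (a + (k j : ℝ)) = (n + 1) * a + ∑ j, k j := by
    simp [Finset.sum_add_distrib]
  rw [dirichletLaw, lintegral_withDensity_eq_lintegral_mul _ (by fun_prop) (by fun_prop)]
  have hD := lintegral_openSimplex_prod_rpow n ht (fun j => a + k j) (fun j => by positivity)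
  set C : ℝ := Real.Gamma ((n + 1) * a) / Real.Gamma a ^ (n + 1) * (1 / t ^ ((n + 1) * a - 1))
    with hC
  have hC0 : 0 ≤ C := by positivity
  have hpt : ∀ s, ((fun s => ENNReal.ofReal (dirichletDensity a t n s)) * fun s =>
      ENNReal.ofReal (∏ j, allTimes t s j ^ k j)) s = (openSimplex t n).indicator (fun s =>
        ENNReal.ofReal C * ENNReal.ofReal (∏ j, allTimes t s j ^ (a + k j - 1))) s := by
    intro s
    simp only [Pi.mul_apply, dirichletDensity]
    by_cases hs : s ∈ openSimplex t n
    · have hp : ∀ j, 0 < allTimes t s j := allTimes_pos hs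
      rw [Set.indicator_of_mem hs, Set.indicator_of_mem hs, ENNReal.ofReal_mul hC0, mul_assoc,
        ← ENNReal.ofReal_mul (Finset.prod_nonneg fun j _ => Real.rpow_nonneg (hp j).le _),
        ← Finset.prod_mul_distrib]
      congr 2
      refine Finset.prod_congr rfl fun j _ => ?_
      rw [show a + k j - 1 = (a - 1) + k j by ring, Real.rpow_add (hp j), Real.rpow_natCast]
    · simp [Set.indicator_of_notMem hs]
  simp_rw [hpt]
  rw [lintegral_indicator (measurableSet_openSimplex t n), lintegral_const_mul _ (by fun_prop), hD,
    ← ENNReal.ofReal_mul hC0, hsum]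
  congr 1
  rw [hC, show (n + 1) * a + ((∑ j, k j : ℕ) : ℝ) - 1 = ((n + 1) * a - 1) + (∑ j, k j : ℕ) by ring,
    Real.rpow_add ht, Real.rpow_natCast, Finset.prod_div_distrib, Finset.prod_const,
    Finset.card_univ, Fintype.card_fin]
  have : t ^ ((n + 1) * a - 1) ≠ 0 := by positivity
  push_cast
  field_simp

theorem isProbabilityMeasure_dirichletLaw {a t : ℝ} (ha : 0 < a) (ht : 0 < t) (n : ℕ) :
    IsProbabilityMeasure (dirichletLaw a t n) := by
  have h := lintegral_dirichletLaw_prod_pow ha ht n 0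
  have hGA : Real.Gamma ((n + 1) * a) ≠ 0 := (Real.Gamma_pos_of_pos (by positivity)).ne'
  have hGa := (Real.Gamma_pos_of_pos ha).ne'
  exact ⟨by simpa [hGA, hGa] using h⟩

theorem ae_mem_openSimplex_dirichletLaw (a t : ℝ) (n : ℕ) :
    ∀ᵐ s ∂dirichletLaw a t n, s ∈ openSimplex t n := by
  have hmeas : Measurable (dirichletDensity a t n) := by
    unfold dirichletDensity
    exact Measurable.indicator (by fun_prop) (measurableSet_openSimplex t n)
  rw [dirichletLaw, ae_withDensity_iff (by fun_prop)]
  refine Filter.Eventually.of_forall fun s h => ?_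
  by_contra hs
  exact h (by simp [dirichletDensity, Set.indicator_of_notMem hs])

theorem integrable_dirichletLaw_prod_pow {a t : ℝ} (ha : 0 < a) (ht : 0 < t) (n : ℕ)
    (k : Fin (n + 1) → ℕ) :
    Integrable (fun s => ∏ j, allTimes t s j ^ k j) (dirichletLaw a t n) := by
  rw [← lintegral_ofReal_ne_top_iff_integrable, lintegral_dirichletLaw_prod_pow ha ht]
  · exact ENNReal.ofReal_ne_top
  · exact Measurable.aestronglyMeasurable (by fun_prop)
  · filter_upwards [ae_mem_openSimplex_dirichletLaw a t n] with s hs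
    exact Finset.prod_nonneg fun j _ => pow_nonneg (allTimes_pos hs j).le _

theorem integral_dirichletLaw_prod_pow {a t : ℝ} (ha : 0 < a) (ht : 0 < t) (n : ℕ)
    (k : Fin (n + 1) → ℕ) :
    ∫ s, ∏ j, allTimes t s j ^ k j ∂dirichletLaw a t n =
      Real.Gamma ((n + 1) * a) / Real.Gamma ((n + 1) * a + ∑ j, k j) *
        t ^ (∑ j, k j) * ∏ j, (Real.Gamma (a + k j) / Real.Gamma a) := by
  rw [integral_eq_lintegral_of_nonneg_ae, lintegral_dirichletLaw_prod_pow ha ht,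
    ENNReal.toReal_ofReal]
  · refine mul_nonneg (mul_nonneg (div_nonneg ?_ ?_) (by positivity))
      (Finset.prod_nonneg fun j _ => div_nonneg ?_ ?_) <;>
    exact (Real.Gamma_pos_of_pos (by positivity)).le
  · filter_upwards [ae_mem_openSimplex_dirichletLaw a t n] with s hs
    exact Finset.prod_nonneg fun j _ => pow_nonneg (allTimes_pos hs j).le _
  · exact Measurable.aestronglyMeasurable (by fun_prop)

/-! ### Moments of the uniform direction and of rotation-invariant densities -/

open Set Measure Module in
/-- Polar coordinates: the moments of a rotation-invariant density split into an angular and a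
radial factor. -/
theorem integral_inner_pow_mul_norm {E : Type*} [NormedAddCommGroup E] [InnerProductSpace ℝ E]
    [FiniteDimensional ℝ E] [MeasurableSpace E] [BorelSpace E] [Nontrivial E]
    (ξ : E) (m : ℕ) (g : ℝ → ℝ) :
    ∫ x : E, inner ℝ ξ x ^ m * g ‖x‖ =
      (∫ v, inner ℝ ξ (v : E) ^ m ∂(volume : Measure E).toSphere) *
        ∫ r in Ioi (0 : ℝ), r ^ (finrank ℝ E - 1) * (r ^ m * g r) := by
  calc ∫ x : E, inner ℝ ξ x ^ m * g ‖x‖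
      = ∫ x : ({(0)}ᶜ : Set E), inner ℝ ξ (x : E) ^ m * g ‖x.1‖
          ∂((volume : Measure E).comap (↑)) := by
        rw [integral_subtype_comap (measurableSet_singleton _).compl
          fun x : E ↦ inner ℝ ξ x ^ m * g (‖x‖), restrict_compl_singleton]
    _ = ∫ p, inner ℝ ξ (p.1 : E) ^ m * ((p.2 : ℝ) ^ m * g p.2)
          ∂(volume : Measure E).toSphere.prod (.volumeIoiPow (finrank ℝ E - 1)) := by
        rw [← (volume : Measure E).measurePreserving_homeomorphUnitSphereProd.integral_comp
          (Homeomorph.measurableEmbedding _)]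
        refine integral_congr_ae (Filter.Eventually.of_forall fun x => ?_)
        have hx : ‖(x : E)‖ ≠ 0 := norm_ne_zero_iff.2 x.2
        simp only [homeomorphUnitSphereProd_apply_snd_coe, homeomorphUnitSphereProd_apply_fst_coe,
          inner_smul_right]
        rw [mul_pow, inv_pow]
        field_simp
    _ = (∫ v, inner ℝ ξ (v : E) ^ m ∂(volume : Measure E).toSphere) *
          ∫ r : Ioi (0 : ℝ), ((r : ℝ) ^ m * g r) ∂.volumeIoiPow (finrank ℝ E - 1) :=
        integral_prod_mul (fun v : Metric.sphere (0 : E) 1 => inner ℝ ξ (v : E) ^ m)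
          (fun r : Ioi (0 : ℝ) => (r : ℝ) ^ m * g r)
    _ = _ := by
      simp only [Measure.volumeIoiPow, ENNReal.ofReal]
      rw [integral_withDensity_eq_integral_smul,
        integral_subtype_comap measurableSet_Ioi
          fun a ↦ Real.toNNReal (a ^ (finrank ℝ E - 1)) • (a ^ m * g a)]
      · congr 1
        refine setIntegral_congr_fun measurableSet_Ioi fun x hx ↦ ?_
        rw [NNReal.smul_def, Real.coe_toNNReal _ (pow_nonneg hx.out.le _), smul_eq_mul]
      · exact (measurable_subtype_coe.pow_const _).real_toNNReal

/-- The moments `∫ x ^ m * exp (-x ^ 2)` of the Gaussian weight. -/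
noncomputable def gaussMoment (m : ℕ) : ℝ :=
  if Even m then Real.Gamma (((m : ℝ) + 1) / 2) else 0

theorem integral_pow_mul_exp_neg_sq (m : ℕ) :
    ∫ x : ℝ, x ^ m * Real.exp (-x ^ 2) = gaussMoment m := by
  by_cases hm : Even m
  · rw [gaussMoment, if_pos hm]
    have h1 : ∀ x : ℝ, x ^ m * Real.exp (-x ^ 2) = |x| ^ m * Real.exp (-|x| ^ 2) := fun x => by
      rw [hm.pow_abs, sq_abs]
    rw [integral_congr_ae (Filter.Eventually.of_forall h1),
      integral_comp_abs (f := fun x => x ^ m * Real.exp (-x ^ 2))]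
    have h2 := integral_rpow_mul_exp_neg_rpow (p := 2) (q := m) (by norm_num)
      (by linarith [(Nat.cast_nonneg m : (0 : ℝ) ≤ m)])
    simp only [Real.rpow_natCast, Real.rpow_ofNat] at h2
    rw [h2]
    ring
  · rw [gaussMoment, if_neg hm]
    have h := integral_neg_eq_self (fun x : ℝ => x ^ m * Real.exp (-x ^ 2)) volume
    simp only [(Nat.not_even_iff_odd.1 hm).neg_pow, neg_sq, neg_mul] at h
    rw [integral_neg] at h
    linarith

theorem gaussMoment_zero : gaussMoment 0 = √Real.pi := by
  rw [gaussMoment, if_pos (by simp), Nat.cast_zero, zero_add, Real.Gamma_one_half_eq]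

theorem EuclideanSpace.exists_eq_norm_smul_unit {d : ℕ} (hd : 0 < d)
    (ξ : EuclideanSpace ℝ (Fin d)) :
    ∃ u : EuclideanSpace ℝ (Fin d), ‖u‖ = 1 ∧ ξ = ‖ξ‖ • u := by
  by_cases h : ξ = 0
  · exact ⟨EuclideanSpace.single ⟨0, hd⟩ 1, by simp, by simp [h]⟩
  · exact ⟨‖ξ‖⁻¹ • ξ, by simp [norm_smul, h], by simp [h]⟩

/-- The Gaussian moments in the direction `ξ`, by a rotation that takes `ξ` to a coordinate axis. -/
theorem integral_inner_pow_mul_exp_neg_norm_sq {d : ℕ} (hd : 0 < d)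
    (ξ : EuclideanSpace ℝ (Fin d)) (m : ℕ) :
    ∫ x, inner ℝ ξ x ^ m * Real.exp (-‖x‖ ^ 2) =
      ‖ξ‖ ^ m * (gaussMoment m * √Real.pi ^ (d - 1)) := by
  obtain ⟨u, hu, hξ⟩ := EuclideanSpace.exists_eq_norm_smul_unit hd ξ
  let i₀ : Fin d := ⟨0, hd⟩
  have hon : Orthonormal ℝ (({i₀} : Set (Fin d)).domRestrict fun _ => u) := by
    refine ⟨fun i => by simpa using hu, fun i j hij => absurd (Subsingleton.elim i j) hij⟩
  obtain ⟨b, hb⟩ := hon.exists_orthonormalBasis_extension_of_card_eq (by simp)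
  have hb0 : b i₀ = u := hb i₀ rfl
  have hin : ∀ x, inner ℝ ξ x = ‖ξ‖ * b.repr x i₀ := fun x => by
    conv_lhs => rw [hξ]
    rw [inner_smul_left, b.repr_apply_apply, hb0]
    simp
  have h1 : ∀ x, inner ℝ ξ x ^ m * Real.exp (-‖x‖ ^ 2) =
      ‖ξ‖ ^ m * ((b.repr x i₀) ^ m * Real.exp (-‖b.repr x‖ ^ 2)) := fun x => by
    rw [hin, mul_pow, b.repr.norm_map, mul_assoc]
  simp_rw [h1]
  rw [integral_const_mul]
  congr 1
  rw [b.measurePreserving_repr.integral_comp b.repr.toHomeomorph.measurableEmbedding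
      (fun y : EuclideanSpace ℝ (Fin d) => (y i₀) ^ m * Real.exp (-‖y‖ ^ 2)),
    ← (EuclideanSpace.volume_preserving_symm_measurableEquiv_toLp (Fin d)).symm.integral_comp
      (MeasurableEquiv.measurableEmbedding _)]
  have h2 : ∀ y : Fin d → ℝ, ((WithLp.toLp 2 y : EuclideanSpace ℝ (Fin d)) i₀) ^ m *
      Real.exp (-‖(WithLp.toLp 2 y : EuclideanSpace ℝ (Fin d))‖ ^ 2) =
      ∏ i, (y i) ^ (if i = i₀ then m else 0) * Real.exp (-(y i) ^ 2) := fun y => by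
    rw [EuclideanSpace.real_norm_sq_eq, Finset.prod_mul_distrib, ← Real.exp_sum,
      Finset.sum_neg_distrib]
    simp [pow_ite]
  have h3 := integral_fintype_prod_eq_prod (𝕜 := ℝ) (μ := fun _ : Fin d => (volume : Measure ℝ))
    (fun i x => x ^ (if i = i₀ then m else 0) * Real.exp (-x ^ 2))
  simp only [integral_pow_mul_exp_neg_sq] at h3
  rw [← volume_pi] at h3
  refine (integral_congr_ae (Filter.Eventually.of_forall h2)).trans (h3.trans ?_)
  rw [← Finset.mul_prod_erase _ _ (Finset.mem_univ i₀), if_pos rfl]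
  congr 1
  rw [Finset.prod_congr rfl (g := fun _ => √Real.pi) (fun i hi => by
    rw [if_neg (Finset.ne_of_mem_erase hi), gaussMoment_zero])]
  simp

/-- The `m`-th moment of a coordinate of a uniformly distributed point of the unit sphere of
`ℝᵈ`. -/
noncomputable def directionMoment (d m : ℕ) : ℝ :=
  gaussMoment m / √Real.pi * (Real.Gamma (d / 2) / Real.Gamma (((m : ℝ) + d) / 2))

/-- The angular moments are found by comparing polar with Cartesian coordinates for the Gaussian
weight. -/
theorem integral_toSphere_inner_pow {d : ℕ} (hd : 0 < d) (ξ : EuclideanSpace ℝ (Fin d)) (m : ℕ) :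
    ∫ v, inner ℝ ξ (v : EuclideanSpace ℝ (Fin d)) ^ m
        ∂(volume : Measure (EuclideanSpace ℝ (Fin d))).toSphere =
      2 * √Real.pi ^ d / Real.Gamma (d / 2) * (‖ξ‖ ^ m * directionMoment d m) := by
  have : NeZero d := ⟨hd.ne'⟩
  have h := integral_inner_pow_mul_norm ξ m (fun r => Real.exp (-r ^ 2))
  rw [integral_inner_pow_mul_exp_neg_norm_sq hd] at h
  have hr := integral_rpow_mul_exp_neg_rpow (p := 2) (q := ((m + d : ℕ) : ℝ) - 1) (by norm_num)
      (by linarith [(Nat.cast_pos.2 (Nat.add_pos_right m hd) : (0 : ℝ) < ((m + d : ℕ) : ℝ))])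
  have hr' : ∫ r in Set.Ioi (0 : ℝ), r ^ (Module.finrank ℝ (EuclideanSpace ℝ (Fin d)) - 1) *
      (r ^ m * Real.exp (-r ^ 2)) = 1 / 2 * Real.Gamma (((m : ℝ) + d) / 2) := by
    rw [sub_add_cancel] at hr
    push_cast at hr
    rw [← hr]
    refine setIntegral_congr_fun measurableSet_Ioi fun x hx => ?_
    have hx0 : (0 : ℝ) < x := hx
    have he : (m : ℝ) + d - 1 = ((d - 1 + m : ℕ) : ℝ) := by
      rw [Nat.cast_add, Nat.cast_sub hd]; push_cast; ring
    simp only [finrank_euclideanSpace, Fintype.card_fin]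
    rw [he, Real.rpow_natCast, pow_add, mul_assoc]
    simp
  rw [hr'] at h
  have hG : 0 < Real.Gamma (((m : ℝ) + d) / 2) := Real.Gamma_pos_of_pos (by positivity)
  have hG' : 0 < Real.Gamma ((d : ℝ) / 2) := Real.Gamma_pos_of_pos (by positivity)
  have hpi : 0 < √Real.pi := by positivity
  have hd' : √Real.pi ^ d = √Real.pi ^ (d - 1) * √Real.pi := by
    rw [← pow_succ, Nat.sub_add_cancel hd]
  rw [directionMoment, hd']
  field_simp
  linarith

theorem directionMoment_zero {d : ℕ} (hd : 0 < d) : directionMoment d 0 = 1 := by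
  have hG' : 0 < Real.Gamma ((d : ℝ) / 2) := Real.Gamma_pos_of_pos (by positivity)
  have hpi : 0 < √Real.pi := by positivity
  rw [directionMoment, gaussMoment_zero, div_self hpi.ne']
  simp [hG'.ne']

theorem toSphere_real_univ {d : ℕ} (hd : 0 < d) :
    (volume : Measure (EuclideanSpace ℝ (Fin d))).toSphere.real Set.univ =
      2 * √Real.pi ^ d / Real.Gamma (d / 2) := by
  have h := integral_toSphere_inner_pow hd 0 0
  simpa [directionMoment_zero hd, -Measure.toSphere_real_apply_univ] using h

theorem isProbabilityMeasure_uniformDirection {d : ℕ} (hd : 0 < d) :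
    IsProbabilityMeasure (uniformDirection d) := by
  have : NeZero d := ⟨hd.ne'⟩
  constructor
  rw [uniformDirection, Measure.smul_apply, smul_eq_mul]
  refine ENNReal.inv_mul_cancel ?_ (measure_ne_top _ _)
  rw [Measure.measure_univ_ne_zero]
  exact Measure.toSphere_ne_zero _

theorem integral_uniformDirection_inner_pow {d : ℕ} (hd : 0 < d) (ξ : EuclideanSpace ℝ (Fin d))
    (m : ℕ) :
    ∫ v, inner ℝ ξ (v : EuclideanSpace ℝ (Fin d)) ^ m ∂uniformDirection d =
      ‖ξ‖ ^ m * directionMoment d m := by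
  have hG' : 0 < Real.Gamma ((d : ℝ) / 2) := Real.Gamma_pos_of_pos (by positivity)
  have hpi : 0 < √Real.pi ^ d := by positivity
  rw [uniformDirection, integral_smul_measure, integral_toSphere_inner_pow hd, ENNReal.toReal_inv,
    ← Measure.real, toSphere_real_univ hd, smul_eq_mul]
  field_simp

/-- The radial integral `∫₀ᴿ r ^ (q - 1) (R² - r²) ^ (β - 1) dr`, by the substitution `u = r²`. -/
theorem integral_rpow_mul_sq_sub_sq_rpow {q β R : ℝ} (hq : 0 < q) (hβ : 0 < β) (hR : 0 < R) :
    ∫ r in Set.Ioi (0 : ℝ), r ^ (q - 1) *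
        (Set.Iio R).indicator (fun r => (R ^ 2 - r ^ 2) ^ (β - 1)) r =
      R ^ (q + 2 * β - 2) * ProbabilityTheory.beta (q / 2) β / 2 := by
  let g : ℝ → ℝ := (Set.Ioo 0 (R ^ 2)).indicator
    fun y => y ^ (q / 2 - 1) * (R ^ 2 - y) ^ (β - 1)
  have hR2 : 0 < R ^ 2 := by positivity
  have hg : ∫ y in Set.Ioi (0 : ℝ), g y =
      R ^ (q + 2 * β - 2) * ProbabilityTheory.beta (q / 2) β := by
    have h := lintegral_Ioo_rpow_mul_rpow (half_pos hq) hβ hR2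
    have hB := ProbabilityTheory.beta_pos (half_pos hq) hβ
    rw [setIntegral_indicator measurableSet_Ioo, Set.inter_eq_right.2 (fun x hx => hx.1),
      integral_eq_lintegral_of_nonneg_ae, h, ENNReal.toReal_ofReal (by positivity),
      ← Real.rpow_natCast R 2, ← Real.rpow_mul hR.le]
    · congr 2
      push_cast
      ring
    · filter_upwards [self_mem_ae_restrict measurableSet_Ioo] with y hy
      exact mul_nonneg (Real.rpow_nonneg hy.1.le _) (Real.rpow_nonneg (sub_nonneg.2 hy.2.le) _)
    · exact Measurable.aestronglyMeasurable (by fun_prop)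
  rw [← hg, ← integral_comp_rpow_Ioi_of_pos (g := g) (p := 2) (by norm_num), div_eq_inv_mul,
    ← integral_const_mul]
  refine setIntegral_congr_fun measurableSet_Ioi fun r hr => ?_
  have hr0 : (0 : ℝ) < r := hr
  simp only [Real.rpow_ofNat, smul_eq_mul]
  by_cases hrR : r < R
  · have h1 : r ^ 2 ∈ Set.Ioo 0 (R ^ 2) := ⟨by positivity, by gcongr⟩
    simp only [g, Set.indicator_of_mem h1, Set.indicator_of_mem (show r ∈ Set.Iio R from hrR)]
    rw [← Real.rpow_natCast r 2, ← Real.rpow_mul hr0.le,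
      show q - 1 = (2 - 1) + ((2 : ℕ) : ℝ) * (q / 2 - 1) by push_cast; ring, Real.rpow_add hr0]
    ring
  · have h1 : r ^ 2 ∉ Set.Ioo 0 (R ^ 2) := fun h => hrR (lt_of_pow_lt_pow_left₀ 2 hR.le h.2)
    simp [g, Set.indicator_of_notMem h1, Set.indicator_of_notMem (show r ∉ Set.Iio R from hrR)]

/-- The density `C (R² - ‖x‖²) ^ (β - 1)` on the ball of radius `R`, with the constant `C` that
gives it total mass `1`. -/
noncomputable def ballDensity (d : ℕ) (β R : ℝ) : EuclideanSpace ℝ (Fin d) → ℝ :=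
  (Metric.ball 0 R).indicator fun x =>
    Real.Gamma (d / 2 + β) / (√Real.pi ^ d * Real.Gamma β * R ^ (d + 2 * β - 2)) *
      (R ^ 2 - ‖x‖ ^ 2) ^ (β - 1)

theorem measurable_ballDensity (d : ℕ) (β R : ℝ) : Measurable (ballDensity d β R) :=
  Measurable.indicator (by fun_prop) measurableSet_ball

theorem ballDensity_nonneg {d : ℕ} {β R : ℝ} (hβ : 0 < β) (hR : 0 < R)
    (x : EuclideanSpace ℝ (Fin d)) : 0 ≤ ballDensity d β R x := by
  refine Set.indicator_nonneg (fun x hx => ?_) x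
  have h1 : 0 < Real.Gamma β := Real.Gamma_pos_of_pos hβ
  have h2 : 0 < Real.Gamma (d / 2 + β) := Real.Gamma_pos_of_pos (by positivity)
  have h3 : 0 ≤ R ^ 2 - ‖x‖ ^ 2 := by
    rw [mem_ball_zero_iff] at hx
    exact sub_nonneg.2 (by gcongr)
  positivity

/-- The moments of `ballDensity`; that of order `0` says that its total mass is `1`. -/
theorem integral_inner_pow_mul_ballDensity {d : ℕ} (hd : 0 < d) {β R : ℝ} (hβ : 0 < β) (hR : 0 < R)
    (ξ : EuclideanSpace ℝ (Fin d)) (m : ℕ) :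
    ∫ x, inner ℝ ξ x ^ m * ballDensity d β R x =
      (R * ‖ξ‖) ^ m * (gaussMoment m / √Real.pi *
        (Real.Gamma (d / 2 + β) / Real.Gamma (m / 2 + (d / 2 + β)))) := by
  have : NeZero d := ⟨hd.ne'⟩
  set C := Real.Gamma (d / 2 + β) / (√Real.pi ^ d * Real.Gamma β * R ^ (d + 2 * β - 2)) with hC
  have h := integral_inner_pow_mul_norm ξ m
    (fun r => C * (Set.Iio R).indicator (fun r => (R ^ 2 - r ^ 2) ^ (β - 1)) r)
  have hl : ∀ x : EuclideanSpace ℝ (Fin d), ballDensity d β R x =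
      C * (Set.Iio R).indicator (fun r => (R ^ 2 - r ^ 2) ^ (β - 1)) ‖x‖ := fun x => by
    by_cases hx : ‖x‖ < R
    · rw [Set.indicator_of_mem (show ‖x‖ ∈ Set.Iio R from hx), ballDensity,
        Set.indicator_of_mem (by simpa using hx)]
    · rw [Set.indicator_of_notMem (show ‖x‖ ∉ Set.Iio R from hx), ballDensity,
        Set.indicator_of_notMem (by simpa using hx), mul_zero]
  simp_rw [hl, h]
  have hq : 0 < (m : ℝ) + d := by positivity
  have hr := integral_rpow_mul_sq_sub_sq_rpow hq hβ hR
  have hr' : ∫ r in Set.Ioi (0 : ℝ), r ^ (Module.finrank ℝ (EuclideanSpace ℝ (Fin d)) - 1) *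
      (r ^ m * (C * (Set.Iio R).indicator (fun r => (R ^ 2 - r ^ 2) ^ (β - 1)) r)) =
      C * (R ^ ((m : ℝ) + d + 2 * β - 2) * ProbabilityTheory.beta (((m : ℝ) + d) / 2) β / 2) := by
    rw [← hr, ← integral_const_mul]
    refine setIntegral_congr_fun measurableSet_Ioi fun x _ => ?_
    have he : (m : ℝ) + d - 1 = ((d - 1 + m : ℕ) : ℝ) := by
      rw [Nat.cast_add, Nat.cast_sub hd]; push_cast; ring
    simp only [finrank_euclideanSpace, Fintype.card_fin]
    rw [he, Real.rpow_natCast, pow_add]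
    ring
  rw [hr', integral_toSphere_inner_pow hd, ProbabilityTheory.beta, directionMoment, hC,
    show (m : ℝ) + d + 2 * β - 2 = m + (d + 2 * β - 2) by ring, Real.rpow_add hR,
    Real.rpow_natCast, mul_pow, show ((m : ℝ) + d) / 2 + β = m / 2 + (d / 2 + β) by ring]
  have h1 : 0 < Real.Gamma β := Real.Gamma_pos_of_pos hβ
  have h2 : 0 < Real.Gamma (((m : ℝ) + d) / 2) := Real.Gamma_pos_of_pos (by positivity)
  have h3 : 0 < Real.Gamma (m / 2 + (d / 2 + β)) := Real.Gamma_pos_of_pos (by positivity)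
  have h4 : 0 < Real.Gamma ((d : ℝ) / 2) := Real.Gamma_pos_of_pos (by positivity)
  have h5 : 0 < R ^ ((d : ℝ) + 2 * β - 2) := by positivity
  have h6 : 0 < √Real.pi := by positivity
  field_simp

theorem integrable_ballDensity {d : ℕ} (hd : 0 < d) {β R : ℝ} (hβ : 0 < β) (hR : 0 < R) :
    Integrable (ballDensity d β R) := by
  have h := integral_inner_pow_mul_ballDensity hd hβ hR 0 0
  have h2 : 0 < Real.Gamma (d / 2 + β) := Real.Gamma_pos_of_pos (by positivity)
  have h6 : 0 < √Real.pi := by positivity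
  simp only [pow_zero, one_mul, gaussMoment_zero, Nat.cast_zero, zero_div, zero_add,
    div_self h2.ne', div_self h6.ne'] at h
  -- The integral of a function that is not integrable would be `0`.
  by_contra hni
  rw [integral_undef hni] at h
  exact zero_ne_one h

/-! ### Measures on a ball are determined by their moments -/

theorem integrable_of_measurable_of_ae_norm_le {E F : Type*} [MeasurableSpace E]
    [NormedAddCommGroup F] {μ : Measure E} [IsFiniteMeasure μ] {f : E → F} {C : ℝ}
    (hf : AEStronglyMeasurable f μ) (hC : ∀ᵐ x ∂μ, ‖f x‖ ≤ C) : Integrable f μ :=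
  (integrable_const C).mono' hf hC

/-- The characteristic function of a measure on a ball is the exponential series of its moments. -/
theorem hasSum_charFun_of_ae_norm_le {E : Type*} [NormedAddCommGroup E] [InnerProductSpace ℝ E]
    [MeasurableSpace E] [BorelSpace E] [SecondCountableTopology E] {μ : Measure E}
    [IsFiniteMeasure μ] {R : ℝ} (hR : ∀ᵐ x ∂μ, ‖x‖ ≤ R) (ξ : E) :
    HasSum (fun m : ℕ => (Complex.I ^ m / m.factorial : ℂ) * ((∫ x, inner ℝ ξ x ^ m ∂μ : ℝ) : ℂ))
      (charFun μ ξ) := by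
  let F : ℕ → E → ℂ := fun m x => (Complex.I ^ m / m.factorial : ℂ) * ((inner ℝ ξ x ^ m : ℝ) : ℂ)
  have hbound : ∀ m, ∀ᵐ x ∂μ, ‖F m x‖ ≤ (‖ξ‖ * R) ^ m / m.factorial := fun m => by
    filter_upwards [hR] with x hx
    have h1 : |inner ℝ ξ x| ≤ ‖ξ‖ * R := (abs_real_inner_le_norm ξ x).trans (by gcongr)
    simp only [F, norm_mul, norm_div, norm_pow, Complex.norm_I, one_pow, Complex.norm_natCast,
      Complex.norm_real, Real.norm_eq_abs]
    rw [one_div, ← div_eq_inv_mul]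
    gcongr
  have hmeas : ∀ m, AEStronglyMeasurable (F m) μ := fun m =>
    Continuous.aestronglyMeasurable (by fun_prop)
  have hint : ∀ m, Integrable (F m) μ := fun m =>
    integrable_of_measurable_of_ae_norm_le (hmeas m) (hbound m)
  have hsum : Summable fun m => ∫ x, ‖F m x‖ ∂μ := by
    refine Summable.of_nonneg_of_le (fun m => integral_nonneg fun x => norm_nonneg _) (fun m => ?_)
      ((Real.summable_pow_div_factorial (‖ξ‖ * R)).mul_right (μ.real Set.univ))
    refine (integral_mono_ae (hint m).norm (integrable_const _) (hbound m)).trans ?_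
    rw [integral_const, smul_eq_mul, mul_comm]
  have h := hasSum_integral_of_summable_integral_norm hint hsum
  have h1 : ∀ m, ∫ x, F m x ∂μ =
      (Complex.I ^ m / m.factorial : ℂ) * ((∫ x, inner ℝ ξ x ^ m ∂μ : ℝ) : ℂ) := fun m => by
    simp only [F]
    rw [integral_const_mul]
    congr 1
    exact integral_ofReal
  have h2 : ∀ x, ∑' m, F m x = Complex.exp (inner ℝ x ξ * Complex.I) := fun x => by
    rw [Complex.exp_eq_exp_ℂ, NormedSpace.exp_eq_tsum_div]
    refine tsum_congr fun m => ?_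
    simp only [F]
    rw [real_inner_comm, mul_pow]
    push_cast
    ring
  simp_rw [h1, h2] at h
  rw [charFun_apply]
  exact h

theorem MeasureTheory.Measure.ext_of_inner_moments {E : Type*} [NormedAddCommGroup E]
    [InnerProductSpace ℝ E] [MeasurableSpace E] [BorelSpace E] [SecondCountableTopology E]
    [CompleteSpace E]
    {μ ν : Measure E} [IsFiniteMeasure μ] [IsFiniteMeasure ν] {R : ℝ}
    (hμ : ∀ᵐ x ∂μ, ‖x‖ ≤ R) (hν : ∀ᵐ x ∂ν, ‖x‖ ≤ R)
    (h : ∀ (ξ : E) (m : ℕ), ∫ x, inner ℝ ξ x ^ m ∂μ = ∫ x, inner ℝ ξ x ^ m ∂ν) : μ = ν := by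
  refine MeasureTheory.Measure.ext_of_charFun (funext fun ξ => ?_)
  have h1 := hasSum_charFun_of_ae_norm_le hμ ξ
  simp_rw [h ξ] at h1
  exact h1.unique (hasSum_charFun_of_ae_norm_le hν ξ)

/-! ### The law of the flight with a given number of changes of direction -/

/-- The position reached by a flight with given times `p.1` and directions `p.2`. -/
noncomputable def positionMap {d : ℕ} (c t : ℝ) (n : ℕ)
    (p : (Fin n → ℝ) × (Fin (n + 1) → Metric.sphere (0 : EuclideanSpace ℝ (Fin d)) 1)) :
    EuclideanSpace ℝ (Fin d) :=
  c • ∑ j, allTimes t p.1 j • (p.2 j : EuclideanSpace ℝ (Fin d))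

/-- The law of the position given that there are `n` changes of direction. -/
noncomputable def conditionalFlightLaw (d : ℕ) (a c t : ℝ) (n : ℕ) :
    Measure (EuclideanSpace ℝ (Fin d)) :=
  ((dirichletLaw a t n).prod (Measure.pi fun _ => uniformDirection d)).map (positionMap c t n)

theorem measurable_positionMap {d : ℕ} (c t : ℝ) (n : ℕ) :
    Measurable (positionMap (d := d) c t n) := by
  have h : ∀ j : Fin (n + 1), Measurable fun p : (Fin n → ℝ) ×
      (Fin (n + 1) → Metric.sphere (0 : EuclideanSpace ℝ (Fin d)) 1) =>
      allTimes t p.1 j • (p.2 j : EuclideanSpace ℝ (Fin d)) := fun j => by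
    have h1 : Measurable fun p : (Fin n → ℝ) ×
        (Fin (n + 1) → Metric.sphere (0 : EuclideanSpace ℝ (Fin d)) 1) => allTimes t p.1 j :=
      (measurable_allTimes_right t j).comp measurable_fst
    have h2 : Measurable fun p : (Fin n → ℝ) ×
        (Fin (n + 1) → Metric.sphere (0 : EuclideanSpace ℝ (Fin d)) 1) =>
        (p.2 j : EuclideanSpace ℝ (Fin d)) :=
      measurable_subtype_coe.comp ((measurable_pi_apply j).comp measurable_snd)
    exact h1.smul h2
  exact (Finset.measurable_fun_sum Finset.univ fun j _ => h j).const_smul c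

theorem isProbabilityMeasure_conditionalFlightLaw {d : ℕ} (hd : 0 < d) {a t : ℝ} (ha : 0 < a)
    (ht : 0 < t) (c : ℝ) (n : ℕ) : IsProbabilityMeasure (conditionalFlightLaw d a c t n) := by
  have := isProbabilityMeasure_uniformDirection hd
  have := isProbabilityMeasure_dirichletLaw ha ht n
  exact Measure.isProbabilityMeasure_map (measurable_positionMap c t n).aemeasurable

theorem ae_norm_le_conditionalFlightLaw {d : ℕ} (hd : 0 < d) {a c t : ℝ} (ha : 0 < a) (hc : 0 < c)
    (ht : 0 < t) (n : ℕ) : ∀ᵐ x ∂conditionalFlightLaw d a c t n, ‖x‖ ≤ c * t := by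
  have := isProbabilityMeasure_uniformDirection hd
  have := isProbabilityMeasure_dirichletLaw ha ht n
  rw [conditionalFlightLaw, ae_map_iff (measurable_positionMap c t n).aemeasurable
    (measurableSet_le measurable_norm measurable_const)]
  have h := Measure.quasiMeasurePreserving_fst
    (μ := dirichletLaw a t n) (ν := Measure.pi fun _ : Fin (n + 1) => uniformDirection d)
    |>.ae (ae_mem_openSimplex_dirichletLaw a t n)
  filter_upwards [h] with p hp
  rw [positionMap, norm_smul, Real.norm_of_nonneg hc.le]
  gcongr
  calc _ ≤ ∑ j, ‖allTimes t p.1 j • (p.2 j : EuclideanSpace ℝ (Fin d))‖ := norm_sum_le _ _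
    _ = ∑ j, allTimes t p.1 j := Finset.sum_congr rfl fun j _ => by
      rw [norm_smul, Real.norm_of_nonneg (allTimes_pos hp j).le]
      simp
    _ = t := sum_allTimes t p.1

/-- The power series `∑ E[τ ^ k ⟨e, V⟩ ^ k] / k! X ^ k`, where `τ` has the gamma law with parameter
`a` and is independent of a uniform direction `V`, and `e` is a unit vector. -/
noncomputable def stepSeries (d : ℕ) (a : ℝ) : PowerSeries ℝ :=
  PowerSeries.mk fun k =>
    Real.Gamma (a + k) / Real.Gamma a / k.factorial * directionMoment d k

/-- The moments of the flight, by the multinomial theorem: the Dirichlet moments and the moments of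
the directions combine to a coefficient of a power of the step series. -/
theorem integral_inner_pow_conditionalFlightLaw {d : ℕ} (hd : 0 < d) {a t : ℝ} (ha : 0 < a)
    (ht : 0 < t) (c : ℝ) (n : ℕ) (ξ : EuclideanSpace ℝ (Fin d)) (m : ℕ) :
    ∫ x, inner ℝ ξ x ^ m ∂conditionalFlightLaw d a c t n =
      (c * t * ‖ξ‖) ^ m * (m.factorial * (Real.Gamma ((n + 1) * a) / Real.Gamma ((n + 1) * a + m)) *
        PowerSeries.coeff m (stepSeries d a ^ (n + 1))) := by
  have := isProbabilityMeasure_uniformDirection hd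
  have := isProbabilityMeasure_dirichletLaw ha ht n
  rw [conditionalFlightLaw, integral_map (measurable_positionMap c t n).aemeasurable
    (Continuous.aestronglyMeasurable (by fun_prop))]
  have hexp : ∀ p : (Fin n → ℝ) × (Fin (n + 1) → Metric.sphere (0 : EuclideanSpace ℝ (Fin d)) 1),
      inner ℝ ξ (positionMap c t n p) ^ m =
      ∑ k ∈ (Finset.univ : Finset (Fin (n + 1))).piAntidiag m,
        (c ^ m * Nat.multinomial Finset.univ k) * ((∏ j, allTimes t p.1 j ^ k j) *
          ∏ j, inner ℝ ξ (p.2 j : EuclideanSpace ℝ (Fin d)) ^ k j) := fun p => by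
    rw [positionMap, inner_smul_right, inner_sum, mul_pow, Finset.sum_pow_eq_sum_piAntidiag,
      Finset.mul_sum]
    refine Finset.sum_congr rfl fun k _ => ?_
    simp_rw [inner_smul_right, mul_pow]
    rw [Finset.prod_mul_distrib, mul_assoc]
  have hV : ∀ k : Fin (n + 1) → ℕ,
      ∫ v : Fin (n + 1) → Metric.sphere (0 : EuclideanSpace ℝ (Fin d)) 1,
        ∏ j, inner ℝ ξ (v j : EuclideanSpace ℝ (Fin d)) ^ k j
        ∂Measure.pi (fun _ => uniformDirection d) =
      ∏ j, (‖ξ‖ ^ k j * directionMoment d (k j)) := fun k => by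
    rw [integral_fintype_prod_eq_prod (𝕜 := ℝ) (μ := fun _ => uniformDirection d)
      (fun j (v : Metric.sphere (0 : EuclideanSpace ℝ (Fin d)) 1) =>
        inner ℝ ξ (v : EuclideanSpace ℝ (Fin d)) ^ k j)]
    simp_rw [integral_uniformDirection_inner_pow hd]
  have hint : ∀ k : Fin (n + 1) → ℕ, Integrable
      (fun p : (Fin n → ℝ) × (Fin (n + 1) → Metric.sphere (0 : EuclideanSpace ℝ (Fin d)) 1) =>
        (∏ j, allTimes t p.1 j ^ k j) * ∏ j, inner ℝ ξ (p.2 j : EuclideanSpace ℝ (Fin d)) ^ k j)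
      ((dirichletLaw a t n).prod (Measure.pi fun _ => uniformDirection d)) := fun k => by
    refine (integrable_dirichletLaw_prod_pow ha ht n k).mul_prod
      (g := fun v : Fin (n + 1) → Metric.sphere (0 : EuclideanSpace ℝ (Fin d)) 1 =>
        ∏ j, inner ℝ ξ (v j : EuclideanSpace ℝ (Fin d)) ^ k j) ?_
    exact Continuous.integrable_of_hasCompactSupport (by fun_prop)
      (HasCompactSupport.of_compactSpace _)
  simp_rw [hexp]
  rw [integral_finsetSum _ fun k _ => (hint k).const_mul _,
    PowerSeries.coeff_pow_eq_sum_piAntidiag, Finset.mul_sum, Finset.mul_sum]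
  refine Finset.sum_congr rfl fun k hk => ?_
  have hkm : ∑ j, k j = m := (Finset.mem_piAntidiag.1 hk).1
  rw [integral_const_mul, integral_prod_mul (fun s => ∏ j, allTimes t s j ^ k j)
    (fun v : Fin (n + 1) → Metric.sphere (0 : EuclideanSpace ℝ (Fin d)) 1 =>
      ∏ j, inner ℝ ξ (v j : EuclideanSpace ℝ (Fin d)) ^ k j), hV,
    integral_dirichletLaw_prod_pow ha ht, hkm]
  have hmult : (Nat.multinomial Finset.univ k : ℝ) = m.factorial / ∏ j, ((k j).factorial : ℝ) := by
    rw [eq_div_iff (Finset.prod_ne_zero_iff.2 fun j _ => by positivity), mul_comm, ← hkm]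
    exact_mod_cast Nat.multinomial_spec Finset.univ k
  simp only [stepSeries, PowerSeries.coeff_mk]
  rw [hmult, Finset.prod_mul_distrib, Finset.prod_pow_eq_pow_sum, hkm, Finset.prod_mul_distrib,
    Finset.prod_div_distrib (f := fun j => Real.Gamma (a + k j) / Real.Gamma a)]
  ring

theorem gaussMoment_two_mul (k : ℕ) :
    gaussMoment (2 * k) / √Real.pi = (2 * k).factorial / (4 ^ k * k.factorial) := by
  have hpi : 0 < √Real.pi := by positivity
  have h := Real.Gamma_mul_Gamma_add_half_of_pos (s := (k : ℝ) + 1 / 2) (by positivity)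
  rw [show (k : ℝ) + 1 / 2 + 1 / 2 = k + 1 by ring, Real.Gamma_nat_eq_factorial,
    show 2 * ((k : ℝ) + 1 / 2) = ((2 * k : ℕ) : ℝ) + 1 by push_cast; ring,
    Real.Gamma_nat_eq_factorial,
    show (1 : ℝ) - (((2 * k : ℕ) : ℝ) + 1) = -((2 * k : ℕ) : ℝ) by ring,
    Real.rpow_neg (by norm_num), Real.rpow_natCast, pow_mul] at h
  rw [gaussMoment, if_pos (even_two_mul k),
    show (((2 * k : ℕ) : ℝ) + 1) / 2 = k + 1 / 2 by push_cast; ring]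
  have hk : (0 : ℝ) < k.factorial := by positivity
  rw [div_eq_div_iff hpi.ne' (by positivity)]
  rw [mul_left_comm, mul_comm (4 ^ k : ℝ), h, show (2 : ℝ) ^ 2 = 4 by norm_num]
  field_simp

theorem gaussMoment_of_odd {m : ℕ} (hm : Odd m) : gaussMoment m = 0 :=
  if_neg (Nat.not_even_iff_odd.2 hm)

/-- A ratio form of Legendre's duplication formula. -/
theorem Gamma_two_mul_add_div (k : ℕ) {p : ℝ} (hp : 0 < p) :
    Real.Gamma (2 * p + 2 * k) / Real.Gamma (2 * p) =
      4 ^ k * (Real.Gamma (p + k) * Real.Gamma (p + k + 1 / 2)) /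
        (Real.Gamma p * Real.Gamma (p + 1 / 2)) := by
  have hpi : 0 < √Real.pi := by positivity
  have h1 := Real.Gamma_mul_Gamma_add_half_of_pos hp
  have h2 := Real.Gamma_mul_Gamma_add_half_of_pos (s := p + k) (by positivity)
  rw [h1, h2, show 1 - 2 * (p + k) = (1 - 2 * p) - ((2 * k : ℕ) : ℝ) by push_cast; ring,
    Real.rpow_sub (by norm_num), Real.rpow_natCast, pow_mul, mul_add]
  have h3 : 0 < Real.Gamma (2 * p) := Real.Gamma_pos_of_pos (by positivity)
  have h4 : (0 : ℝ) < 2 ^ (1 - 2 * p) := by positivity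
  norm_num
  field_simp

/-- If the step series is Rothe's series at `(κ X) ^ 2`, then so are its powers, by the Rothe–Hagen
identity, and the law of the flight is recognised by its moments. -/
theorem conditionalFlightLaw_eq_of_stepSeries {d : ℕ} (hd : 0 < d) {a c t β κ p : ℝ} (ha : 0 < a)
    (hc : 0 < c) (ht : 0 < t) (hβ : 0 < β) (s n : ℕ)
    (hstep : ∀ k : ℕ, Real.Gamma (a + 2 * k) / Real.Gamma a / (2 * k).factorial *
      directionMoment d (2 * k) = κ ^ (2 * k) * rotheCoeff s k p)
    (hmom : ∀ k : ℕ, (2 * k).factorial *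
      (Real.Gamma ((n + 1) * a) / Real.Gamma ((n + 1) * a + 2 * k)) *
      (κ ^ (2 * k) * rotheCoeff s k ((n + 1) * p)) =
        (2 * k).factorial / (4 ^ k * k.factorial) *
          (Real.Gamma (d / 2 + β) / Real.Gamma (k + (d / 2 + β)))) :
    conditionalFlightLaw d a c t n =
      volume.withDensity fun x => ENNReal.ofReal (ballDensity d β (c * t) x) := by
  have hR : 0 < c * t := by positivity
  have hseries : stepSeries d a =
      PowerSeries.rescale κ (PowerSeries.expand 2 two_ne_zero (rotheSeries s p)) := by
    ext m
    rw [PowerSeries.coeff_rescale]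
    rcases Nat.even_or_odd' m with ⟨k, rfl | rfl⟩
    · rw [PowerSeries.coeff_expand_mul, stepSeries, rotheSeries, PowerSeries.coeff_mk,
        PowerSeries.coeff_mk, ← hstep]
      push_cast
      rfl
    · rw [PowerSeries.coeff_expand_of_not_dvd _ _ _ (by omega), stepSeries, PowerSeries.coeff_mk,
        directionMoment, gaussMoment_of_odd ⟨k, rfl⟩]
      simp
  have := isProbabilityMeasure_conditionalFlightLaw hd ha ht c n
  have : IsFiniteMeasure (volume.withDensity fun x => ENNReal.ofReal (ballDensity d β (c * t) x)) :=
    isFiniteMeasure_withDensity_ofReal (integrable_ballDensity hd hβ hR).2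
  have hmeas : Measurable fun x => ENNReal.ofReal (ballDensity d β (c * t) x) :=
    (measurable_ballDensity d β (c * t)).ennreal_ofReal
  refine Measure.ext_of_inner_moments (ae_norm_le_conditionalFlightLaw hd ha hc ht n) (R := c * t)
    ?_ fun ξ m => ?_
  · rw [ae_withDensity_iff hmeas]
    refine Filter.Eventually.of_forall fun x hx => ?_
    by_contra h
    exact hx (by rw [ballDensity, Set.indicator_of_notMem (by simpa using (not_le.1 h).le),
      ENNReal.ofReal_zero])
  · rw [integral_inner_pow_conditionalFlightLaw hd ha ht,
      integral_withDensity_eq_integral_toReal_smul hmeas (by simp)]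
    simp_rw [ENNReal.toReal_ofReal (ballDensity_nonneg hβ hR _), smul_eq_mul,
      mul_comm (ballDensity _ _ _ _)]
    rw [integral_inner_pow_mul_ballDensity hd hβ hR]
    congr 1
    rw [hseries, ← map_pow, ← map_pow, rotheSeries_pow, PowerSeries.coeff_rescale]
    rcases Nat.even_or_odd' m with ⟨k, rfl | rfl⟩
    · have h := hmom k
      rw [PowerSeries.coeff_expand_mul, rotheSeries, PowerSeries.coeff_mk, gaussMoment_two_mul]
      push_cast at h ⊢
      rw [h, mul_div_cancel_left₀ _ (two_ne_zero' ℝ)]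
    · rw [PowerSeries.coeff_expand_of_not_dvd _ _ _ (by omega), gaussMoment_of_odd ⟨k, rfl⟩]
      simp

/-- For Dirichlet parameter `d - 1` the step series is `(1 - X ^ 2) ^ (-(d - 1) / 2)`. -/
theorem conditionalFlightLaw_sub_one {d : ℕ} (hd : 2 ≤ d) {c t : ℝ} (hc : 0 < c) (ht : 0 < t)
    {n : ℕ} (hn : 0 < n) :
    conditionalFlightLaw d ((d : ℝ) - 1) c t n = volume.withDensity fun x =>
      ENNReal.ofReal (ballDensity d (n * (((d : ℝ) - 1) / 2)) (c * t) x) := by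
  have hd' : (2 : ℝ) ≤ d := by exact_mod_cast hd
  have hn' : (0 : ℝ) < n := by exact_mod_cast hn
  have hdp : ∃ p : ℝ, 0 < p ∧ (d : ℝ) - 1 = 2 * p ∧ (d : ℝ) = 2 * p + 1 :=
    ⟨(d - 1) / 2, by linarith, by ring, by ring⟩
  obtain ⟨p, hp, hdp, hdp'⟩ := hdp
  have hpp : 2 * p / 2 = p := by ring
  rw [hdp, hpp]
  refine conditionalFlightLaw_eq_of_stepSeries (κ := 1) (p := p) (by omega) (by positivity) hc ht
    (by positivity) 1 n (fun k => ?_) (fun k => ?_)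
  · rw [directionMoment, gaussMoment_two_mul, Gamma_two_mul_add_div k hp, rotheCoeff_one_eq k hp]
    push_cast
    rw [hdp', show (2 * p + 1) / 2 = p + 1 / 2 by ring,
      show (2 * (k : ℝ) + (2 * p + 1)) / 2 = p + k + 1 / 2 by ring]
    have h1 : 0 < Real.Gamma p := Real.Gamma_pos_of_pos hp
    have h2 : 0 < Real.Gamma (p + 1 / 2) := Real.Gamma_pos_of_pos (by positivity)
    have h3 : 0 < Real.Gamma (p + k + 1 / 2) := Real.Gamma_pos_of_pos (by positivity)
    rw [one_pow]
    field_simp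
  · have hP : 0 < (n + 1) * p := by positivity
    have h := Gamma_two_mul_add_div k hP
    rw [rotheCoeff_one_eq k hP, show ((n : ℝ) + 1) * (2 * p) = 2 * ((n + 1) * p) by ring,
      ← inv_div (Real.Gamma (2 * ((n + 1) * p) + 2 * k)), h, hdp',
      show (2 * p + 1) / 2 + n * p = (n + 1) * p + 1 / 2 by ring,
      show (k : ℝ) + ((n + 1) * p + 1 / 2) = (n + 1) * p + k + 1 / 2 by ring]
    have h1 : 0 < Real.Gamma ((n + 1) * p) := Real.Gamma_pos_of_pos hP
    have h2 : 0 < Real.Gamma ((n + 1) * p + 1 / 2) := Real.Gamma_pos_of_pos (by positivity)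
    have h3 : 0 < Real.Gamma ((n + 1) * p + k + 1 / 2) := Real.Gamma_pos_of_pos (by positivity)
    have h4 : 0 < Real.Gamma ((n + 1) * p + k) := Real.Gamma_pos_of_pos (by positivity)
    rw [one_pow]
    field_simp

/-- For Dirichlet parameter `d / 2 - 1` the step series is `C (X ^ 2 / 4) ^ (d / 2 - 1)`, where
`C = 1 + X * C ^ 2` is the generating function of the Catalan numbers. -/
theorem conditionalFlightLaw_half_sub_one {d : ℕ} (hd : 3 ≤ d) {c t : ℝ} (hc : 0 < c) (ht : 0 < t)
    {n : ℕ} (hn : 0 < n) :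
    conditionalFlightLaw d ((d : ℝ) / 2 - 1) c t n = volume.withDensity fun x =>
      ENNReal.ofReal (ballDensity d (n * ((d : ℝ) / 2 - 1)) (c * t) x) := by
  have hd' : (3 : ℝ) ≤ d := by exact_mod_cast hd
  have hn' : (0 : ℝ) < n := by exact_mod_cast hn
  have hdp : ∃ p : ℝ, 0 < p ∧ (d : ℝ) / 2 - 1 = p ∧ (d : ℝ) = 2 * p + 2 :=
    ⟨d / 2 - 1, by linarith, by ring, by ring⟩
  obtain ⟨p, hp, hdp, hdp'⟩ := hdp
  have h4 : ∀ k : ℕ, (1 / 2 : ℝ) ^ (2 * k) = 1 / 4 ^ k := fun k => by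
    rw [pow_mul, ← one_div_pow]; norm_num
  rw [hdp]
  refine conditionalFlightLaw_eq_of_stepSeries (κ := 1 / 2) (p := p) (by omega) hp hc ht
    (by positivity) 2 n (fun k => ?_) (fun k => ?_)
  · rw [directionMoment, gaussMoment_two_mul, rotheCoeff_two_eq k hp, h4]
    push_cast
    rw [hdp', show (2 * p + 2) / 2 = p + 1 by ring, Real.Gamma_add_one hp.ne',
      show (2 * (k : ℝ) + (2 * p + 2)) / 2 = p + k + 1 by ring]
    have h1 : 0 < Real.Gamma p := Real.Gamma_pos_of_pos hp
    have h3 : 0 < Real.Gamma (p + k + 1) := Real.Gamma_pos_of_pos (by positivity)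
    field_simp
  · have hP : 0 < (n + 1) * p := by positivity
    rw [rotheCoeff_two_eq k hP, h4, hdp',
      show (2 * p + 2) / 2 + n * p = (n + 1) * p + 1 by ring, Real.Gamma_add_one hP.ne',
      show (k : ℝ) + ((n + 1) * p + 1) = (n + 1) * p + k + 1 by ring]
    have h2 : 0 < Real.Gamma ((n + 1) * p + 2 * k) := Real.Gamma_pos_of_pos (by positivity)
    have h3 : 0 < Real.Gamma ((n + 1) * p + k + 1) := Real.Gamma_pos_of_pos (by positivity)
    field_simp

/-! ### Mixing over the number of changes of direction -/

/-- The law of the position is the mixture of its laws given the number of changes of direction. -/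
theorem IsRandomFlight.map_flightPosition {Ω : Type*} [MeasurableSpace Ω] {P : Measure Ω}
    [IsProbabilityMeasure P] {d : ℕ} {a t : ℝ} {N : Ω → ℕ} {τ : ℕ → Ω → ℝ}
    {V : ℕ → Ω → Metric.sphere (0 : EuclideanSpace ℝ (Fin d)) 1} (h : IsRandomFlight P a t N τ V)
    (c : ℝ) :
    P.map (flightPosition c t N τ V) =
      Measure.sum fun n => P (N ⁻¹' {n}) • conditionalFlightLaw d a c t n := by
  let Z : (n : ℕ) → Ω →
      (Fin n → ℝ) × (Fin (n + 1) → Metric.sphere (0 : EuclideanSpace ℝ (Fin d)) 1) :=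
    fun n ω => ((fun j : Fin n => τ j ω), (fun j : Fin (n + 1) => V j ω))
  have hZ : ∀ n, Measurable (Z n) := fun n =>
    (measurable_pi_lambda (fun ω (j : Fin n) => τ j ω) fun j => h.measurable_time j).prodMk
      (measurable_pi_lambda (fun ω (j : Fin (n + 1)) => V j ω) fun j => h.measurable_direction j)
  have hN : ∀ n, MeasurableSet (N ⁻¹' {n}) := fun n =>
    h.measurable_number (measurableSet_singleton n)
  have hpos : ∀ (s : Set (EuclideanSpace ℝ (Fin d))) (n : ℕ),
      N ⁻¹' {n} ∩ flightPosition c t N τ V ⁻¹' s =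
        N ⁻¹' {n} ∩ Z n ⁻¹' (positionMap c t n ⁻¹' s) := by
    intro s n
    ext ω
    simp only [Set.mem_inter_iff, Set.mem_preimage, Set.mem_singleton_iff]
    refine and_congr_right fun hω => ?_
    subst hω
    rfl
  have hunion : ∀ s : Set (EuclideanSpace ℝ (Fin d)), flightPosition c t N τ V ⁻¹' s =
      ⋃ n, N ⁻¹' {n} ∩ flightPosition c t N τ V ⁻¹' s := by
    intro s
    rw [← Set.iUnion_inter]
    ext ω; simp
  have hmeas : ∀ s : Set (EuclideanSpace ℝ (Fin d)), MeasurableSet s → ∀ n,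
      MeasurableSet (N ⁻¹' {n} ∩ flightPosition c t N τ V ⁻¹' s) := fun s hs n => by
    rw [hpos]
    exact (hN n).inter (hZ n (measurable_positionMap c t n hs))
  have hX : Measurable (flightPosition c t N τ V) := fun s hs => by
    rw [hunion]
    exact MeasurableSet.iUnion (hmeas s hs)
  ext s hs
  rw [Measure.map_apply hX hs, Measure.sum_apply _ hs, hunion, measure_iUnion _ (hmeas s hs)]
  · refine tsum_congr fun n => ?_
    rw [hpos, Measure.smul_apply, smul_eq_mul]
    by_cases h0 : P (N ⁻¹' {n}) = 0
    · rw [h0, zero_mul]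
      exact measure_mono_null Set.inter_subset_left h0
    · rw [← ProbabilityTheory.cond_mul_eq_inter (hN n), mul_comm, conditionalFlightLaw,
        ← h.law_given_number n h0, Measure.map_map (measurable_positionMap c t n) (hZ n),
        Measure.map_apply ((measurable_positionMap c t n).comp (hZ n)) hs]
      rfl
  · intro m n hmn
    refine Set.disjoint_left.2 fun ω hm hn => hmn ?_
    exact (hm.1 : N ω = m).symm.trans hn.1

/-- Without changes of direction the point ends on the sphere of radius `c t`. -/
theorem conditionalFlightLaw_zero_mutuallySingular {d : ℕ} (hd : 0 < d) (a : ℝ) {c t : ℝ}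
    (hc : 0 < c) (ht : 0 < t) :
    (conditionalFlightLaw d a c t 0).MutuallySingular volume := by
  have : NeZero d := ⟨hd.ne'⟩
  have hms : MeasurableSet (Metric.sphere (0 : EuclideanSpace ℝ (Fin d)) (c * t)) :=
    Metric.isClosed_sphere.measurableSet
  refine ⟨(Metric.sphere 0 (c * t))ᶜ, hms.compl, ?_, ?_⟩
  · rw [conditionalFlightLaw, Measure.map_apply (measurable_positionMap c t 0) hms.compl]
    refine measure_mono_null (t := ∅) (fun p hp => hp ?_) measure_empty
    have h0 : allTimes t p.1 0 = t := by simpa using sum_allTimes t p.1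
    simp [positionMap, h0, norm_smul, abs_of_pos hc, abs_of_pos ht]
  · rw [compl_compl]
    exact Measure.addHaar_sphere _ _ _

/-- It is enough to split a finite measure into a singular part and a part with an
`ℝ≥0∞`-valued density. -/
theorem hasAbsContDensity_toReal {d : ℕ} {ν μ₀ : Measure (EuclideanSpace ℝ (Fin d))}
    [IsFiniteMeasure ν] {g : EuclideanSpace ℝ (Fin d) → ENNReal} (hg : Measurable g)
    (hμ₀ : μ₀.MutuallySingular volume) (h : ν = μ₀ + volume.withDensity g) :
    HasAbsContDensity ν fun x => (g x).toReal := by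
  refine ⟨hg.ennreal_toReal, fun x => ENNReal.toReal_nonneg, ?_⟩
  have hfin : ∫⁻ x, g x ≠ ⊤ := by
    rw [← setLIntegral_univ, ← withDensity_apply _ MeasurableSet.univ]
    refine ne_top_of_le_ne_top (measure_ne_top ν Set.univ) ?_
    rw [h]
    exact le_add_self
  have hae : (fun x => ENNReal.ofReal (g x).toReal) =ᵐ[volume] g := by
    filter_upwards [ae_lt_top hg hfin] with x hx using ENNReal.ofReal_toReal hx.ne
  rw [withDensity_congr_ae hae, ← Measure.eq_singularPart hg hμ₀ h]
  exact h

/-- The terms of the mixture are, up to a common factor, those of the Mittag-Leffler series. -/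
theorem fractionalPoissonWeight_mul_ballDensity {d : ℕ} (hd : 0 < d) {ν R x : ℝ} (hν : 0 < ν)
    (hR : 0 < R) (n : ℕ) {y : EuclideanSpace ℝ (Fin d)} (hy : ‖y‖ < R) :
    fractionalPoissonWeight ν (d / 2) x (n + 1) * ballDensity d ((n + 1 : ℕ) * ν) R y =
      x / Real.pi ^ ((d : ℝ) / 2) * ((R ^ 2 - ‖y‖ ^ 2) ^ (ν - 1) / R ^ (d + 2 * ν - 2)) /
        mittagLeffler ν (d / 2) x *
          ((x * (R ^ 2 - ‖y‖ ^ 2) ^ ν / R ^ (2 * ν)) ^ n / Real.Gamma (ν * n + ν)) := by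
  have hu : 0 < R ^ 2 - ‖y‖ ^ 2 := sub_pos.2 (by gcongr)
  have h1 : 0 < Real.Gamma (ν * n + ν) := Real.Gamma_pos_of_pos (by positivity)
  have h2 : 0 < Real.Gamma ((d : ℝ) / 2 + (ν * n + ν)) := Real.Gamma_pos_of_pos (by positivity)
  have hpi : Real.pi ^ ((d : ℝ) / 2) = √Real.pi ^ d := by
    rw [Real.sqrt_eq_rpow, ← Real.rpow_natCast, ← Real.rpow_mul Real.pi_pos.le]
    ring_nf
  rw [ballDensity, Set.indicator_of_mem (by simpa using hy), fractionalPoissonWeight, hpi]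
  push_cast
  rw [show ν * ((n : ℝ) + 1) + d / 2 = d / 2 + (ν * n + ν) by ring,
    show ((n : ℝ) + 1) * ν = ν * n + ν by ring,
    show ν * n + ν - 1 = (ν - 1) + ν * n by ring,
    show (d : ℝ) + 2 * (ν * n + ν) - 2 = (d + 2 * ν - 2) + 2 * ν * n by ring,
    Real.rpow_add hu, Real.rpow_add hR, Real.rpow_mul hu.le, Real.rpow_mul hR.le,
    Real.rpow_natCast, Real.rpow_natCast, pow_succ, div_pow, mul_pow]
  have h3 : 0 < √Real.pi ^ d := by positivity
  field_simp

/-- If, given `n ≥ 1` changes of direction, the position has the density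
`ballDensity d (n ν) (c t)`, then under the fractional Poisson law of `n` these densities add up
to a Mittag-Leffler function. -/
theorem IsRandomFlight.hasAbsContDensity {Ω : Type*} [MeasurableSpace Ω] {P : Measure Ω}
    [IsProbabilityMeasure P] {d : ℕ} (hd : 0 < d) {a c t x ν : ℝ} (hc : 0 < c) (ht : 0 < t)
    (hν : 0 < ν) {N : Ω → ℕ} {τ : ℕ → Ω → ℝ}
    {V : ℕ → Ω → Metric.sphere (0 : EuclideanSpace ℝ (Fin d)) 1} (h : IsRandomFlight P a t N τ V)
    (hN : ∀ n : ℕ, P.real (N ⁻¹' {n}) = fractionalPoissonWeight ν (d / 2) x n)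
    (hlaw : ∀ n : ℕ, 0 < n → conditionalFlightLaw d a c t n = volume.withDensity fun y =>
      ENNReal.ofReal (ballDensity d (n * ν) (c * t) y)) :
    HasAbsContDensity (P.map (flightPosition c t N τ V))
      ((Metric.ball 0 (c * t)).indicator fun y =>
        x / Real.pi ^ ((d : ℝ) / 2) *
          (((c * t) ^ 2 - ‖y‖ ^ 2) ^ (ν - 1) / (c * t) ^ (d + 2 * ν - 2)) /
          mittagLeffler ν (d / 2) x *
            mittagLeffler ν ν (x * ((c * t) ^ 2 - ‖y‖ ^ 2) ^ ν / (c * t) ^ (2 * ν))) := by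
  have hR : 0 < c * t := by positivity
  let w : ℕ → ℝ := fractionalPoissonWeight ν (d / 2) x
  have hw : ∀ n, 0 ≤ w n := fun n => measureReal_nonneg.trans_eq (hN n)
  have hNw : ∀ n, P (N ⁻¹' {n}) = ENNReal.ofReal (w n) := fun n => by
    rw [← ofReal_measureReal, hN n]
  let F : ℕ → EuclideanSpace ℝ (Fin d) → ENNReal := fun n y =>
    ENNReal.ofReal (w (n + 1) * ballDensity d ((n + 1 : ℕ) * ν) (c * t) y)
  have hF : ∀ n, Measurable (F n) := fun n =>
    ((measurable_ballDensity _ _ _).const_mul _).ennreal_ofReal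
  have hsplit : P.map (flightPosition c t N τ V) =
      P (N ⁻¹' {0}) • conditionalFlightLaw d a c t 0 + volume.withDensity (∑' n, F n) := by
    rw [h.map_flightPosition, withDensity_tsum hF]
    ext s hs
    rw [Measure.sum_apply _ hs, Measure.add_apply, Measure.sum_apply _ hs,
      tsum_eq_zero_add' ENNReal.summable]
    congr 1
    refine tsum_congr fun n => ?_
    rw [hlaw (n + 1) n.succ_pos, hNw, ← withDensity_smul _
      (measurable_ballDensity _ _ _).ennreal_ofReal]
    congr 2
    funext y
    rw [Pi.smul_apply, smul_eq_mul, ← ENNReal.ofReal_mul (hw _)]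
  have := Measure.isFiniteMeasure_map P (flightPosition c t N τ V)
  have hdens := hasAbsContDensity_toReal (Measurable.tsum' hF)
    ((conditionalFlightLaw_zero_mutuallySingular hd a hc ht).smul _) hsplit
  refine Eq.subst (motive := HasAbsContDensity _) ?_ hdens
  funext y
  have hnonneg : ∀ n, 0 ≤ w (n + 1) * ballDensity d ((n + 1 : ℕ) * ν) (c * t) y := fun n =>
    mul_nonneg (hw _) (ballDensity_nonneg (by positivity) hR y)
  -- The real series is the `toReal` of the `ℝ≥0∞`-valued one even where it diverges, both being `0`
  -- there; the finite mass of the law makes the set of such points a null set.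
  rw [tsum_apply (Pi.summable.2 fun _ => ENNReal.summable),
    ENNReal.tsum_toReal_eq fun n => ENNReal.ofReal_ne_top,
    tsum_congr fun n => ENNReal.toReal_ofReal (hnonneg n)]
  by_cases hy : ‖y‖ < c * t
  · rw [Set.indicator_of_mem (by simpa using hy), mittagLeffler.eq_1 ν ν, ← tsum_mul_left]
    exact tsum_congr fun n => fractionalPoissonWeight_mul_ballDensity hd hν hR n hy
  · rw [Set.indicator_of_notMem (by simpa using hy)]
    refine (tsum_congr fun n => ?_).trans tsum_zero
    rw [ballDensity, Set.indicator_of_notMem (by simpa using hy), mul_zero]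

theorem theorem5 {Ω : Type*} [MeasurableSpace Ω] (P : Measure Ω) [IsProbabilityMeasure P]
    (d : ℕ) (c lam t : ℝ) (hc : 0 < c) (hlam : 0 < lam) (ht : 0 < t)
    (N : Ω → ℕ) (τ : ℕ → Ω → ℝ)
    (V : ℕ → Ω → Metric.sphere (0 : EuclideanSpace ℝ (Fin d)) 1) :
    (2 ≤ d → IsRandomFlight P ((d : ℝ) - 1) t N τ V →
      (∀ n : ℕ, P.real (N ⁻¹' {n}) =
        fractionalPoissonWeight (((d : ℝ) - 1) / 2) ((d : ℝ) / 2) (lam * t) n) →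
      HasAbsContDensity (P.map (flightPosition c t N τ V))
        ((Metric.ball 0 (c * t)).indicator fun x =>
          lam * t / Real.pi ^ ((d : ℝ) / 2) *
            ((c ^ 2 * t ^ 2 - ‖x‖ ^ 2) ^ (((d : ℝ) - 1) / 2 - 1) /
              (c * t) ^ (2 * ((d : ℝ) - 1) - 1)) *
            (mittagLeffler (((d : ℝ) - 1) / 2) (((d : ℝ) - 1) / 2)
                (lam * t * (c ^ 2 * t ^ 2 - ‖x‖ ^ 2) ^ (((d : ℝ) - 1) / 2) /
                  (c * t) ^ ((d : ℝ) - 1)) /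
              mittagLeffler (((d : ℝ) - 1) / 2) ((d : ℝ) / 2) (lam * t)))) ∧
    (3 ≤ d → IsRandomFlight P ((d : ℝ) / 2 - 1) t N τ V →
      (∀ n : ℕ, P.real (N ⁻¹' {n}) =
        fractionalPoissonWeight ((d : ℝ) / 2 - 1) ((d : ℝ) / 2) (lam * t) n) →
      HasAbsContDensity (P.map (flightPosition c t N τ V))
        ((Metric.ball 0 (c * t)).indicator fun y =>
          lam * t / Real.pi ^ ((d : ℝ) / 2) *
            ((c ^ 2 * t ^ 2 - ‖y‖ ^ 2) ^ ((d : ℝ) / 2 - 2) /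
              (c * t) ^ (4 * ((d : ℝ) / 2 - 1))) *
            (mittagLeffler ((d : ℝ) / 2 - 1) ((d : ℝ) / 2 - 1)
                (lam * t * (c ^ 2 * t ^ 2 - ‖y‖ ^ 2) ^ ((d : ℝ) / 2 - 1) /
                  (c * t) ^ ((d : ℝ) - 2)) /
              mittagLeffler ((d : ℝ) / 2 - 1) ((d : ℝ) / 2) (lam * t)))) := by

  constructor
  · intro hd h hN
    have hd' : (2 : ℝ) ≤ d := by exact_mod_cast hd
    have hdens := h.hasAbsContDensity (c := c) (ν := ((d : ℝ) - 1) / 2) (by omega) hc ht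
      (by linarith) hN fun n hn => conditionalFlightLaw_sub_one hd hc ht hn
    refine Eq.subst (motive := HasAbsContDensity _) ?_ hdens
    congr 1
    funext y
    rw [mul_pow, show 2 * (((d : ℝ) - 1) / 2) = d - 1 by ring,
      show (d : ℝ) + (d - 1) - 2 = 2 * ((d : ℝ) - 1) - 1 by ring]
    ring
  · intro hd h hN
    have hd' : (3 : ℝ) ≤ d := by exact_mod_cast hd
    have hdens := h.hasAbsContDensity (c := c) (ν := (d : ℝ) / 2 - 1) (by omega) hc ht
      (by linarith) hN fun n hn => conditionalFlightLaw_half_sub_one hd hc ht hn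
    refine Eq.subst (motive := HasAbsContDensity _) ?_ hdens
    congr 1
    funext y
    rw [mul_pow, show 2 * ((d : ℝ) / 2 - 1) = d - 2 by ring,
      show (d : ℝ) + (d - 2) - 2 = 4 * ((d : ℝ) / 2 - 1) by ring,
      show (d : ℝ) / 2 - 1 - 1 = d / 2 - 2 by ring]
    ring
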